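/- For an irrational real number $\alpha$ with regular continued fraction $[a_0;a_1,a_2,\ldots]$ and convergents $p_n/q_n=[a_0;a_1,\ldots,a_n]$, put $$\psi^{[2]}_\alpha(t)=\min\{\|q\alpha\| : q\in\mathbb{Z},\ 1\le q\le t,\ q\notin\{q_1,q_2,\ldots\}\},\qquad \lambda^{[2]}(\alpha)=\limsup_{t\to\infty}\bigl(t\,\psi^{[2]}_\alpha(t)\bigr)^{-1}\in[0,+\infty],$$ where $\|x\|$ is the distance from $x$ to the nearest integer. Let $\mathbb{L}_2$ be the set of all real numbers $\lambda$ such that $\lambda=\lambda^{[2]}(\alpha)$ for some irrational $\alpha$. Two irrational numbers $\alpha,\beta$ are called equivalent, $\alpha\sim\beta$, if $\alpha_n=\beta_m$ for some $n,m$, where $\alpha_n=[a_n;a_{n+1},\ldots]$ is the $n$-th complete quotient of $\alpha$, and $\beta_m$ that of $\beta$. Below, $(w)_m$ denotes a word $w$ of partial quotients repeated $m$ times, and an overline denotes infinite periodic repetition. Put $\lambda_1=\frac{\sqrt5}{4}$, $\lambda_2=\frac{\sqrt{17}}{4}$, and for $n\ge 3$ $$\lambda_n=\frac{[3;\overline{(1,1,3)_{2n-5},1,1,1,1,3}]+[0;\overline{1,1,1,1,(3,1,1)_{2n-5},3}]}{4},\qquad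 \xi_n=[0;\overline{1,1,1,1,3,(1,1,3)_{2n-5}}],$$ and let $\lambda_\infty=\frac{3\sqrt{17}+21}{32}$. Theorem 1. 1. $\lambda_1<\lambda_2<\lambda_3<\cdots$, $\lim_{n\to\infty}\lambda_n=\lambda_\infty$, and the part of $\mathbb{L}_2$ below $\lambda_\infty$ is exactly the discrete set $$(-\infty,\lambda_\infty)\cap\mathbb{L}_2=\{\lambda_1,\lambda_2,\ldots,\lambda_n,\ldots\}.$$ Moreover, $\lambda_\infty\in\mathbb{L}_2$. 2. For every $n\ge 3$, if an irrational number $\alpha$ satisfies $\lambda^{[2]}(\alpha)=\lambda_n$, then $\alpha\sim\xi_n$. -/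

import Mathlib

open Filter Topology

noncomputable section

namespace SecondLagrange

/-- The distance `‖x‖` from a real number to the nearest integer. -/
def distInt (x : ℝ) : ℝ := |x - round x|

/-- The set `{q₁, q₂, …}` of denominators of the convergents `p_n / q_n = [a₀; a₁, …, a_n]`,
`n ≥ 1`, of the regular continued fraction of `α`. -/
def convDens (α : ℝ) : Set ℕ :=
  {q | ∃ n : ℕ, 1 ≤ n ∧ (q : ℝ) = (GenContFract.of α).dens n}

/-- The irrationality measure function `ψ^{[2]}_α(t)`: the minimum of `‖q α‖` over the integers
`1 ≤ q ≤ t` that are not denominators of convergents to `α`.  The set is finite, and nonempty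
for all sufficiently large `t`, so that the infimum is a minimum there. -/
def psi2 (α t : ℝ) : ℝ :=
  sInf {x : ℝ | ∃ q : ℕ, 1 ≤ q ∧ (q : ℝ) ≤ t ∧ q ∉ convDens α ∧ x = distInt (q * α)}

/-- `λ^{[2]}(α) = limsup_{t → ∞} (t ψ^{[2]}_α(t))⁻¹`, possibly `+∞`. -/
def lambda2 (α : ℝ) : EReal :=
  limsup (fun t : ℝ => (((t * psi2 α t)⁻¹ : ℝ) : EReal)) atTop

/-- The second Lagrange spectrum `𝕃₂`: the finite values of `λ^{[2]}` at irrational numbers. -/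
def spectrum2 : Set ℝ := {l | ∃ α : ℝ, Irrational α ∧ lambda2 α = (l : EReal)}

/-- The complete quotients `α_n = [a_n; a_{n+1}, …]` of an irrational number `α`. -/
def completeQuotient (α : ℝ) : ℕ → ℝ
  | 0 => α
  | n + 1 => (Int.fract (completeQuotient α n))⁻¹

/-- Two irrational numbers are equivalent if they share a complete quotient. -/
def Equivalent (α β : ℝ) : Prop :=
  ∃ n m : ℕ, completeQuotient α n = completeQuotient β m

/-- The finite continued fraction `[a 0; a 1, …, a n]`. -/
def cfConvergent : (ℕ → ℕ) → ℕ → ℝ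
  | a, 0 => (a 0 : ℝ)
  | a, n + 1 => (a 0 : ℝ) + 1 / cfConvergent (fun i => a (i + 1)) n

/-- The value of the infinite continued fraction `[a 0; a 1, a 2, …]`; the limit exists as soon
as `a i ≥ 1` for all `i ≥ 1`. -/
def cfValue (a : ℕ → ℕ) : ℝ := limUnder atTop (cfConvergent a)

/-- The word `w` repeated `m` times. -/
def rep (m : ℕ) (w : List ℕ) : List ℕ := (List.replicate m w).flatten

/-- The sequence `b, w, w, w, …`: one letter `b`, then the word `w` repeated forever. -/
def periodicFrom (b : ℕ) (w : List ℕ) : ℕ → ℕ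
  | 0 => b
  | i + 1 => w.getD (i % w.length) 0

/-- `ξ_n = [0; \overline{1,1,1,1,3,(1,1,3)_{2n-5}}]`, for `n ≥ 3`. -/
def xi (n : ℕ) : ℝ :=
  cfValue (periodicFrom 0 ([1, 1, 1, 1, 3] ++ rep (2 * n - 5) [1, 1, 3]))

/-- The numbers `λ_n`, `n ≥ 1`: `λ₁ = √5 / 4`, `λ₂ = √17 / 4`, and for `n ≥ 3`
`λ_n = ([3; \overline{(1,1,3)_{2n-5},1,1,1,1,3}] + [0; \overline{1,1,1,1,(3,1,1)_{2n-5},3}]) / 4`.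
The value at `n = 0` plays no role. -/
def lam (n : ℕ) : ℝ :=
  if n = 1 then √5 / 4
  else if n = 2 then √17 / 4
  else
    (cfValue (periodicFrom 3 (rep (2 * n - 5) [1, 1, 3] ++ [1, 1, 1, 1, 3])) +
      cfValue (periodicFrom 0 ([1, 1, 1, 1] ++ rep (2 * n - 5) [3, 1, 1] ++ [3]))) / 4

/-- `λ_∞ = (3√17 + 21) / 32`. -/
def lamInf : ℝ := (3 * √17 + 21) / 32

end SecondLagrange

end

/-!
For an irrational `α` the number `λ^{[2]}(α)` is the upper limit of `1 / (q ‖q α‖)` over the `q`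
that are not denominators of convergents (`le_lambda2`, `lambda2_le`). Writing `(q, p)` in the basis
of two consecutive convergents shows that `q ‖q α‖ ≥ 1` unless `(q, p)` is a multiple of a
convergent or an intermediate fraction (`le_mul_abs_of_between`). With `l` and `r` the continued
fractions to the left and to the right of a partial quotient `a`, these exceptions contribute
`(a + l + r) / 4` and `1 / (c + l) + 1 / (a - c + r)`, `1 ≤ c < a`. So values of `λ^{[2]}` that are
at least `1` are upper limits of these expressions; the value `√5 / 4 < 1` needs a finer estimate
at partial quotients `1` (`two_mul_le_mul_abs_of_between`).

If all these values stay below `λ_∞`, then the partial quotients are eventually `1` or `3`, and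
between consecutive `3`s there are two or four `1`s, a short or a long gap
(`Expansion.eventually_gaps`). A gap acts on tails as one of the Möbius maps
`shortGap z = [0; 1, 1, 3 + z]` and `longGap z = [0; 1, 1, 1, 1, 3 + z]`. Both reverse the order.
If `z₁` and `z₂` are the tails on the two sides of a long gap, the condition at the two `3`s that
bound it reads `longGap z₁ + z₂ < longGap η + η` and `longGap z₂ + z₁ < longGap η + η`, where `η` is
the fixed point of `shortGap`. As `longGap` is a strong contraction, both `z₁` and `z₂` are smaller
than `η`; as `shortGap` reverses the order, the number of short gaps up to the next long gap is
then odd on both sides. In the coordinate `linCoord`, in which `shortGap` is the multiplication by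
`-mult`, two different odd numbers would give deviations from `η` whose ratio is at least about
`mult⁻²`, which exceeds what the two conditions allow (`eq_of_longGap_add_lt`). Hence the
expansion ends in `1`s, in the period `1, 1, 3`, or in the period of some `ξ_n`
(`Expansion.classification`).

Conversely, in a chain of long gaps separated by runs of short gaps the upper limit is attained at
the long gaps (`lambda2_of_isChain`). This computes `λ^{[2]}` for the numbers above, and gives
`λ_∞` when the lengths of the runs tend to infinity; numbers with prescribed runs exist by
`exists_isChain`. The order of the `λ_n` is read off from `linCoord`.
-/

noncomputable section

namespace SecondLagrange

/-! ### Expansions of irrational numbers -/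

/-- The data read off at each partial quotient of an infinite continued fraction: `b n` is the
partial quotient, `r n = [0; b (n+1), b (n+2), …]` the tail to its right, and `l n` a tail to its
left, `l (n+1) = 1 / (b n + l n)`. The starting value `l 0` is arbitrary in `[0, 1]`, so that
truncations of an expansion are expansions. -/
structure Expansion (b : ℕ → ℕ) (l r : ℕ → ℝ) : Prop where
  one_le : ∀ n, 1 ≤ b n
  l_nonneg : ∀ n, 0 ≤ l n
  l_le_one : ∀ n, l n ≤ 1
  l_succ : ∀ n, l (n + 1) = 1 / (b n + l n)
  r_pos : ∀ n, 0 < r n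
  r_lt_one : ∀ n, r n < 1
  r_eq : ∀ n, r n = 1 / (b (n + 1) + r (n + 1))

theorem Expansion.shift {b : ℕ → ℕ} {l r : ℕ → ℝ} (h : Expansion b l r) (N : ℕ) :
    Expansion (fun n => b (N + n)) (fun n => l (N + n)) (fun n => r (N + n)) :=
  ⟨fun _ => h.one_le _, fun _ => h.l_nonneg _, fun _ => h.l_le_one _, fun _ => h.l_succ _,
    fun _ => h.r_pos _, fun _ => h.r_lt_one _, fun _ => h.r_eq _⟩

/-- The partial quotient `a_{n+1}` of `α`. -/
def digit (α : ℝ) (n : ℕ) : ℕ := ⌊completeQuotient α (n + 1)⌋₊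

/-- The tail `[0; a_{n+2}, a_{n+3}, …]` of the continued fraction of `α`. -/
def rightTail (α : ℝ) (n : ℕ) : ℝ := Int.fract (completeQuotient α (n + 1))

/-- `contDen b (n + 1)` is the denominator `q_n` when `b n` is the partial quotient `a_{n+1}`;
the sequence starts with `q_{-1} = 0`. -/
def contDen (b : ℕ → ℕ) : ℕ → ℕ
  | 0 => 0
  | 1 => 1
  | n + 2 => b n * contDen b (n + 1) + contDen b n

/-- The numerators that belong to `contDen`, starting with `p_{-1} = 1` and `p_0 = a₀`. -/
def contNum (a₀ : ℤ) (b : ℕ → ℕ) : ℕ → ℤ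
  | 0 => 1
  | 1 => a₀
  | n + 2 => b n * contNum a₀ b (n + 1) + contNum a₀ b n

/-- The quotient `q_{n-1} / q_n = [0; a_n, …, a_1]`. -/
def leftTail (b : ℕ → ℕ) (n : ℕ) : ℝ := contDen b n / contDen b (n + 1)

theorem irrational_completeQuotient {α : ℝ} (hα : Irrational α) (n : ℕ) :
    Irrational (completeQuotient α n) := by
  induction n with
  | zero => exact hα
  | succ n ih =>
    simp only [completeQuotient, irrational_inv_iff]
    exact ih.sub_intCast _

theorem fract_pos_of_irrational {x : ℝ} (hx : Irrational x) : 0 < Int.fract x :=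
  (Int.fract_nonneg x).lt_of_ne' fun h => by
    rw [Int.fract_eq_zero_iff] at h
    obtain ⟨z, rfl⟩ := h
    exact hx ⟨z, by simp⟩

theorem one_lt_completeQuotient {α : ℝ} (hα : Irrational α) (n : ℕ) :
    1 < completeQuotient α (n + 1) :=
  (one_lt_inv₀ (fract_pos_of_irrational (irrational_completeQuotient hα n))).2
    (Int.fract_lt_one _)

theorem completeQuotient_eq_digit_add {α : ℝ} (hα : Irrational α) (n : ℕ) :
    completeQuotient α (n + 1) = digit α n + rightTail α n := by
  have h := one_lt_completeQuotient hα n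
  rw [digit, rightTail, natCast_floor_eq_intCast_floor (by linarith)]
  exact (Int.floor_add_fract _).symm

theorem contDen_add_two (b : ℕ → ℕ) (n : ℕ) :
    contDen b (n + 2) = b n * contDen b (n + 1) + contDen b n := rfl

theorem contDen_pos {b : ℕ → ℕ} (hb : ∀ n, 1 ≤ b n) : ∀ n, 0 < contDen b (n + 1)
  | 0 => one_pos
  | n + 1 => by
    have := contDen_pos hb n
    have := hb n
    simp only [contDen]
    positivity

theorem contDen_le_succ {b : ℕ → ℕ} (hb : ∀ n, 1 ≤ b n) : ∀ n, contDen b n ≤ contDen b (n + 1)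
  | 0 => Nat.zero_le _
  | n + 1 => by
    simp only [contDen]
    nlinarith [hb n, contDen_pos hb n]

theorem contDen_lt_succ {b : ℕ → ℕ} (hb : ∀ n, 1 ≤ b n) (n : ℕ) :
    contDen b (n + 2) < contDen b (n + 3) := by
  have h1 := contDen_pos hb n
  have h2 := contDen_pos hb (n + 1)
  rw [contDen_add_two b (n + 1)]
  nlinarith [hb (n + 1)]

theorem contDen_mono {b : ℕ → ℕ} (hb : ∀ n, 1 ≤ b n) : Monotone (contDen b) :=
  monotone_nat_of_le_succ (contDen_le_succ hb)

theorem le_contDen {b : ℕ → ℕ} (hb : ∀ n, 1 ≤ b n) (n : ℕ) : n ≤ contDen b (n + 1) := by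
  induction n with
  | zero => exact Nat.zero_le _
  | succ n ih =>
    rcases n with _ | n
    · exact contDen_pos hb 1
    · exact Nat.succ_le_of_lt (ih.trans_lt (contDen_lt_succ hb n))

theorem leftTail_succ {b : ℕ → ℕ} (hb : ∀ n, 1 ≤ b n) (n : ℕ) :
    leftTail b (n + 1) = 1 / (b n + leftTail b n) := by
  have h : (0 : ℝ) < contDen b (n + 1) := by exact_mod_cast contDen_pos hb n
  rw [leftTail, leftTail, contDen]
  push_cast
  field_simp

theorem digit_pos {α : ℝ} (hα : Irrational α) (n : ℕ) : 1 ≤ digit α n :=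
  Nat.le_floor (by simpa using (one_lt_completeQuotient hα n).le)

theorem rightTail_eq {α : ℝ} (hα : Irrational α) (n : ℕ) :
    rightTail α n = 1 / (digit α (n + 1) + rightTail α (n + 1)) := by
  rw [← completeQuotient_eq_digit_add hα (n + 1), completeQuotient, rightTail]
  simp

theorem expansion {α : ℝ} (hα : Irrational α) :
    Expansion (digit α) (leftTail (digit α)) (rightTail α) where
  one_le := digit_pos hα
  l_nonneg n := by rw [leftTail]; positivity
  l_le_one n := by
    have h : (0 : ℝ) < contDen (digit α) (n + 1) := by exact_mod_cast contDen_pos (digit_pos hα) n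
    rw [leftTail, div_le_one h]
    exact_mod_cast contDen_le_succ (digit_pos hα) n
  l_succ := leftTail_succ (digit_pos hα)
  r_pos n := fract_pos_of_irrational (irrational_completeQuotient hα _)
  r_lt_one n := Int.fract_lt_one _
  r_eq := rightTail_eq hα

theorem completeQuotient_succ_eq (α : ℝ) (n : ℕ) :
    completeQuotient α (n + 1) = completeQuotient (Int.fract α)⁻¹ n := by
  induction n with
  | zero => rfl
  | succ n ih => rw [completeQuotient, ih, completeQuotient]

theorem get?_of_eq_head (α : ℝ) (n : ℕ) :
    (GenContFract.of α).s.get? n = (GenContFract.of (completeQuotient α n)).s.head := by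
  induction n generalizing α with
  | zero => rfl
  | succ n ih => rw [GenContFract.of_s_succ, ih, completeQuotient_succ_eq]

theorem get?_of {α : ℝ} (hα : Irrational α) (n : ℕ) :
    (GenContFract.of α).s.get? n = some ⟨1, digit α n⟩ := by
  rw [get?_of_eq_head, GenContFract.of_s_head
    (fract_pos_of_irrational (irrational_completeQuotient hα n)).ne', digit,
    natCast_floor_eq_intCast_floor (by linarith [one_lt_completeQuotient hα n])]
  rfl

/-- A number whose complete quotients are never integers is irrational. -/
theorem irrational_of_fract_completeQuotient {α : ℝ}
    (h : ∀ n, Int.fract (completeQuotient α n) ≠ 0) : Irrational α := by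
  rintro ⟨q, hq⟩
  obtain ⟨n, hn⟩ := (GenContFract.terminates_iff_rat α).2 ⟨q, hq.symm⟩
  have h' := get?_of_eq_head α n
  rw [GenContFract.of_s_head (h n)] at h'
  rw [Stream'.Seq.TerminatedAt, h'] at hn
  exact Option.some_ne_none _ hn

theorem dens_eq {α : ℝ} (hα : Irrational α) (n : ℕ) :
    (GenContFract.of α).dens n = contDen (digit α) (n + 1) := by
  induction n using Nat.strong_induction_on with
  | _ n ih =>
    match n with
    | 0 => simp [contDen]
    | 1 => rw [GenContFract.first_den_eq (get?_of hα 0)]; simp [contDen]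
    | n + 2 =>
      rw [GenContFract.dens_recurrence (get?_of hα (n + 1)) (ih n (by omega))
        (ih (n + 1) (by omega)), contDen_add_two _ (n + 1)]
      push_cast
      ring

/-- The index shift: the denominators `q_1, q_2, …` are `contDen b 2, contDen b 3, …`. -/
theorem mem_convDens {α : ℝ} (hα : Irrational α) (q : ℕ) :
    q ∈ convDens α ↔ ∃ n, 2 ≤ n ∧ q = contDen (digit α) n := by
  simp only [convDens, Set.mem_ofPred_eq, dens_eq hα, Nat.cast_inj]
  constructor
  · rintro ⟨n, h1, h2⟩
    exact ⟨n + 1, by omega, h2⟩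
  · rintro ⟨n, h1, h2⟩
    exact ⟨n - 1, by omega, by rwa [Nat.sub_add_cancel (by omega)]⟩

/-- The signed error `q_{n-1} α - p_{n-1}`. -/
def err (α : ℝ) (n : ℕ) : ℝ := contDen (digit α) n * α - contNum ⌊α⌋ (digit α) n

/-- Consecutive errors have opposite signs, and their ratio is a complete quotient. -/
theorem err_eq {α : ℝ} (hα : Irrational α) (n : ℕ) :
    err α n = -(digit α n + rightTail α n) * err α (n + 1) := by
  induction n with
  | zero =>
    rw [← completeQuotient_eq_digit_add hα]
    have h := fract_pos_of_irrational hα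
    simp only [err, contDen, contNum, completeQuotient]
    push_cast
    have e : 1 * α - (⌊α⌋ : ℝ) = Int.fract α := by rw [one_mul]; rfl
    rw [e]
    field_simp
    ring
  | succ n ih =>
    have e : err α (n + 2) = digit α n * err α (n + 1) + err α n := by
      simp only [err, contDen, contNum]
      push_cast
      ring
    have h := rightTail_eq hα n
    have h1 := (expansion hα).r_pos (n + 1)
    have h2 : 0 < (digit α (n + 1) : ℝ) + rightTail α (n + 1) := by positivity
    rw [eq_div_iff h2.ne'] at h
    rw [e, ih]
    linear_combination (-err α (n + 1)) * h

theorem contNum_mul_sub (a₀ : ℤ) (b : ℕ → ℕ) (n : ℕ) :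
    contNum a₀ b n * contDen b (n + 1) - contNum a₀ b (n + 1) * contDen b n = (-1) ^ n := by
  induction n with
  | zero => simp [contDen, contNum]
  | succ n ih =>
    simp only [contDen, contNum]
    push_cast
    rw [pow_succ]
    linear_combination (-1) * ih

/-- The error of a convergent: `q_n |q_n α - p_n| = 1 / (a_{n+1} + l + r)`. -/
theorem abs_err_mul {α : ℝ} (hα : Irrational α) (n : ℕ) :
    |err α (n + 1)| * contDen (digit α) (n + 1) *
      (digit α n + leftTail (digit α) n + rightTail α n) = 1 := by
  have hQ : (0 : ℝ) < contDen (digit α) (n + 1) := by exact_mod_cast contDen_pos (digit_pos hα) n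
  have hl := (expansion hα).l_nonneg n
  have hr := (expansion hα).r_pos n
  have h := err_eq hα n
  have hd : (contNum ⌊α⌋ (digit α) n * contDen (digit α) (n + 1) -
      contNum ⌊α⌋ (digit α) (n + 1) * contDen (digit α) n : ℝ) = (-1) ^ n := by
    exact_mod_cast contNum_mul_sub ⌊α⌋ (digit α) n
  have e : err α (n + 1) * contDen (digit α) (n + 1) *
      (digit α n + leftTail (digit α) n + rightTail α n) = (-1) ^ n := by
    rw [← hd]
    have h3 : leftTail (digit α) n * contDen (digit α) (n + 1) = contDen (digit α) n := by
      rw [leftTail]; field_simp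
    simp only [err] at h ⊢
    linear_combination (contDen (digit α) (n + 1) : ℝ) * h +
      (contDen (digit α) (n + 1) * α - contNum ⌊α⌋ (digit α) (n + 1)) * h3
  have e2 := congrArg abs e
  rw [abs_mul, abs_mul, abs_pow, abs_neg, abs_one, one_pow, abs_of_pos hQ,
    abs_of_pos (by positivity : (0 : ℝ) < digit α n + leftTail (digit α) n + rightTail α n)] at e2
  exact e2

/-! ### Approximations by numbers that are not convergents -/

theorem distInt_pos {α : ℝ} (hα : Irrational α) {q : ℕ} (hq : 1 ≤ q) : 0 < distInt (q * α) := by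
  rw [distInt, abs_pos, sub_ne_zero]
  exact fun h => (hα.natCast_mul (by omega : q ≠ 0)) ⟨round (q * α), by simpa using h.symm⟩

theorem psi2_le {α t : ℝ} {q : ℕ} (h1 : 1 ≤ q) (ht : (q : ℝ) ≤ t) (hq : q ∉ convDens α) :
    psi2 α t ≤ distInt (q * α) := by
  refine csInf_le ⟨0, ?_⟩ ⟨q, h1, ht, hq, rfl⟩
  rintro _ ⟨k, -, -, -, rfl⟩
  exact abs_nonneg _

theorem exists_psi2_eq {α t : ℝ} {q : ℕ} (h1 : 1 ≤ q) (ht : (q : ℝ) ≤ t) (hq : q ∉ convDens α) :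
    ∃ k : ℕ, 1 ≤ k ∧ (k : ℝ) ≤ t ∧ k ∉ convDens α ∧ psi2 α t = distInt (k * α) := by
  have hne : {x : ℝ | ∃ q : ℕ, 1 ≤ q ∧ (q : ℝ) ≤ t ∧ q ∉ convDens α ∧
      x = distInt (q * α)}.Nonempty := ⟨_, q, h1, ht, hq, rfl⟩
  have hfin : {x : ℝ | ∃ q : ℕ, 1 ≤ q ∧ (q : ℝ) ≤ t ∧ q ∉ convDens α ∧
      x = distInt (q * α)}.Finite := by
    refine ((Set.finite_Iic ⌊t⌋₊).image fun k : ℕ => distInt (k * α)).subset ?_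
    rintro _ ⟨k, -, hk, -, rfl⟩
    exact ⟨k, Nat.le_floor hk, rfl⟩
  exact hne.csInf_mem hfin

/-- Every sequence of `q → ∞` that are not denominators of convergents bounds `λ^{[2]}` below. -/
theorem le_lambda2 {α L : ℝ} (hα : Irrational α)
    (h : ∀ N : ℕ, ∃ q : ℕ, N ≤ q ∧ q ∉ convDens α ∧ ∃ p : ℤ, L ≤ (q * |q * α - p|)⁻¹) :
    (L : EReal) ≤ lambda2 α := by
  refine le_limsup_of_frequently_le ?_ (by isBoundedDefault)
  rw [frequently_atTop]
  intro T
  obtain ⟨q, hN, hq, p, hL⟩ := h (max 1 ⌈T⌉₊)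
  have h1 : 1 ≤ q := (le_max_left _ _).trans hN
  have hq0 : (0 : ℝ) < q := by exact_mod_cast h1
  refine ⟨q, (Nat.le_ceil T).trans (by exact_mod_cast (le_max_right _ _).trans hN), ?_⟩
  obtain ⟨k, hk1, -, -, hk⟩ := exists_psi2_eq h1 le_rfl hq
  have hpos : 0 < psi2 α q := hk ▸ distInt_pos hα hk1
  have hle : psi2 α q ≤ |q * α - p| := (psi2_le h1 le_rfl hq).trans (round_le _ _)
  exact_mod_cast hL.trans (inv_anti₀ (by positivity) (by gcongr))

/-- Conversely `λ^{[2]}` is bounded by what all large `q` that are not denominators of convergents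
achieve; the second hypothesis makes `ψ^{[2]}` tend to `0`. -/
theorem lambda2_le {α L : ℝ} (hα : Irrational α) (Q₀ : ℕ)
    (h : ∀ q : ℕ, Q₀ ≤ q → 1 ≤ q → q ∉ convDens α → (q * distInt (q * α))⁻¹ ≤ L)
    (hsmall : ∀ δ > 0, ∃ q : ℕ, 1 ≤ q ∧ q ∉ convDens α ∧ distInt (q * α) < δ) :
    lambda2 α ≤ (L : EReal) := by
  obtain ⟨δ, hδ, hδ'⟩ : ∃ δ > 0, ∀ q : ℕ, 1 ≤ q → q < Q₀ → δ ≤ distInt (q * α) := by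
    clear h
    induction Q₀ with
    | zero => exact ⟨1, one_pos, fun q _ h => by omega⟩
    | succ N ih =>
      obtain ⟨δ, hδ, h⟩ := ih
      rcases Nat.eq_zero_or_pos N with rfl | hN
      · exact ⟨1, one_pos, fun q _ h => by omega⟩
      refine ⟨min δ (distInt (N * α)), lt_min hδ (distInt_pos hα hN), fun q h1 hq => ?_⟩
      rcases Nat.lt_succ_iff_lt_or_eq.1 hq with hq | rfl
      · exact (min_le_left _ _).trans (h q h1 hq)
      · exact min_le_right _ _
  obtain ⟨s, hs1, hs, hsδ⟩ := hsmall δ hδ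
  refine limsup_le_of_le (by isBoundedDefault) ?_
  filter_upwards [eventually_ge_atTop (s : ℝ)] with t ht
  obtain ⟨k, hk1, hkt, hk, he⟩ := exists_psi2_eq hs1 ht hs
  have hkQ : Q₀ ≤ k := by
    by_contra! hlt
    have := hδ' k hk1 hlt
    have := psi2_le hs1 ht hs
    linarith
  have hk0 : (0 : ℝ) < k := by exact_mod_cast hk1
  have hd := distInt_pos hα hk1
  rw [he]
  exact_mod_cast (inv_anti₀ (by positivity) (by gcongr)).trans (h k hkQ hk1 hk)

theorem not_mem_convDens_of_lt {α : ℝ} (hα : Irrational α) {k q : ℕ}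
    (h1 : contDen (digit α) k < q) (h2 : q < contDen (digit α) (k + 1)) : q ∉ convDens α := by
  rw [mem_convDens hα]
  rintro ⟨n, -, rfl⟩
  have hm := contDen_mono (digit_pos hα)
  have := hm.reflect_lt h1
  have := hm.reflect_lt h2
  omega

/-- `2 q_n` lies strictly between two consecutive denominators: between `q_n` and `q_{n+1}` if
`a_{n+1} ≥ 2`, and between `q_{n+1}` and `q_{n+2}` if `a_{n+1} = 1`. -/
theorem two_mul_not_mem_convDens {α : ℝ} (hα : Irrational α) {n : ℕ} (hn : 2 ≤ n) :
    2 * contDen (digit α) (n + 1) ∉ convDens α := by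
  have hb := digit_pos hα
  obtain ⟨n, rfl⟩ := Nat.exists_eq_add_of_le' hn
  have h0 := contDen_pos hb (n + 1)
  have h1 := contDen_lt_succ hb n
  have e2 := contDen_add_two (digit α) (n + 2)
  have e3 := contDen_add_two (digit α) (n + 3)
  rcases (hb (n + 2)).eq_or_lt with h | h
  · rw [← h] at e2
    refine not_mem_convDens_of_lt hα (k := n + 4) ?_ ?_
    · show contDen (digit α) (n + 2 + 2) < 2 * contDen (digit α) (n + 3)
      rw [e2]
      simp only [add_assoc, Nat.reduceAdd]
      omega
    · have := Nat.mul_le_mul_right (contDen (digit α) (n + 4)) (hb (n + 3))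
      simp only [add_assoc, Nat.reduceAdd] at *
      omega
  · refine not_mem_convDens_of_lt hα (k := n + 3) ?_ ?_
    · simp only [add_assoc, Nat.reduceAdd] at *
      omega
    · have := Nat.mul_le_mul_right (contDen (digit α) (n + 3)) h
      simp only [add_assoc, Nat.reduceAdd] at *
      omega

theorem inv_two_mul_contDen {α : ℝ} (hα : Irrational α) (n : ℕ) :
    ((2 * contDen (digit α) (n + 1) : ℝ) * |2 * contDen (digit α) (n + 1) * α -
      2 * contNum ⌊α⌋ (digit α) (n + 1)|)⁻¹ =
      (digit α n + leftTail (digit α) n + rightTail α n) / 4 := by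
  have h := abs_err_mul hα n
  have e : |2 * contDen (digit α) (n + 1) * α - 2 * contNum ⌊α⌋ (digit α) (n + 1)| =
      2 * |err α (n + 1)| := by
    rw [← abs_two, ← abs_mul, err, abs_two]; ring_nf
  rw [e]
  rw [inv_eq_iff_eq_inv]
  rw [inv_div, eq_div_iff (by rintro h0; rw [h0, mul_zero] at h; exact zero_ne_one h)]
  linear_combination 4 * h

/-- The error of the intermediate fraction `(c p_n + p_{n-1}) / (c q_n + q_{n-1})`. -/
theorem inv_intermediate {α : ℝ} (hα : Irrational α) (n : ℕ) {c : ℕ} (h1 : 1 ≤ c)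
    (h2 : c < digit α n) :
    ((c * contDen (digit α) (n + 1) + contDen (digit α) n : ℝ) *
      |(c * contDen (digit α) (n + 1) + contDen (digit α) n : ℝ) * α -
        (c * contNum ⌊α⌋ (digit α) (n + 1) + contNum ⌊α⌋ (digit α) n)|)⁻¹ =
      1 / (c + leftTail (digit α) n) + 1 / (digit α n - c + rightTail α n) := by
  have h := abs_err_mul hα n
  have hQ : (0 : ℝ) < contDen (digit α) (n + 1) := by exact_mod_cast contDen_pos (digit_pos hα) n
  have hl := (expansion hα).l_nonneg n
  have hr := (expansion hα).r_pos n
  have hc : (0 : ℝ) < c := by exact_mod_cast h1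
  have hcb : (c : ℝ) < digit α n := by exact_mod_cast h2
  have h3 : (contDen (digit α) n : ℝ) = leftTail (digit α) n * contDen (digit α) (n + 1) := by
    rw [leftTail]; field_simp
  have e : (c * contDen (digit α) (n + 1) + contDen (digit α) n : ℝ) * α -
        (c * contNum ⌊α⌋ (digit α) (n + 1) + contNum ⌊α⌋ (digit α) n) =
        -(digit α n - c + rightTail α n) * err α (n + 1) := by
    have := err_eq hα n
    simp only [err] at this ⊢
    linear_combination this
  have hpos : 0 < (digit α n : ℝ) - c + rightTail α n := by linarith
  have hpos' : 0 < (c : ℝ) + leftTail (digit α) n := by linarith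
  rw [e, abs_mul, abs_neg, abs_of_pos hpos, h3]
  rw [inv_eq_iff_eq_inv]
  rw [div_add_div _ _ hpos'.ne' hpos.ne', inv_div, eq_div_iff (by nlinarith)]
  linear_combination ((c : ℝ) + leftTail (digit α) n) *
    ((digit α n : ℝ) - c + rightTail α n) * h

/-- The lower bounds for `λ^{[2]}` given by the multiples `2 q_n` and by the intermediate
fractions. -/
theorem eventually_lt_of_lambda2_lt {α L : ℝ} (hα : Irrational α) (h : lambda2 α < (L : EReal)) :
    ∀ᶠ n in atTop, (digit α n + leftTail (digit α) n + rightTail α n) / 4 < L ∧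
      ∀ c : ℕ, 1 ≤ c → c < digit α n →
        1 / (c + leftTail (digit α) n) + 1 / (digit α n - c + rightTail α n) < L := by
  by_contra hcon
  refine h.not_ge (le_lambda2 hα fun N => ?_)
  rw [not_eventually, frequently_atTop] at hcon
  obtain ⟨n, hn, hbad⟩ := hcon (N + 2)
  have hb := digit_pos hα
  have hle : n ≤ contDen (digit α) (n + 1) := le_contDen hb n
  by_cases hM : (digit α n + leftTail (digit α) n + rightTail α n) / 4 < L
  · simp only [hM, true_and, not_forall, not_lt] at hbad
    obtain ⟨c, h1, h2, hc⟩ := hbad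
    have h0 : 0 < contDen (digit α) n := by
      obtain ⟨m, rfl⟩ := Nat.exists_eq_add_of_le' (show 1 ≤ n by omega)
      exact contDen_pos hb m
    have hc1 := Nat.mul_le_mul_right (contDen (digit α) (n + 1)) h1
    have hc2 := Nat.mul_le_mul_right (contDen (digit α) (n + 1)) h2
    have hc3 := contDen_add_two (digit α) n
    have hc4 : (c + 1) * contDen (digit α) (n + 1) =
      c * contDen (digit α) (n + 1) + contDen (digit α) (n + 1) := by ring
    refine ⟨c * contDen (digit α) (n + 1) + contDen (digit α) n, by omega,
      not_mem_convDens_of_lt hα (k := n + 1) (by omega) ?_,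
      c * contNum ⌊α⌋ (digit α) (n + 1) + contNum ⌊α⌋ (digit α) n, ?_⟩
    · have := contDen_pos hb n
      simp only [add_assoc, Nat.reduceAdd] at *
      have hc5 : (c.succ) * contDen (digit α) (n + 1) =
        c * contDen (digit α) (n + 1) + contDen (digit α) (n + 1) := by
        rw [Nat.succ_mul]
      omega
    · push_cast
      rw [inv_intermediate hα n h1 h2]
      exact hc
  · refine ⟨2 * contDen (digit α) (n + 1), by omega, two_mul_not_mem_convDens hα (by omega),
      2 * contNum ⌊α⌋ (digit α) (n + 1), ?_⟩
    push_cast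
    rw [inv_two_mul_contDen hα n]
    exact not_lt.1 hM

theorem exists_distInt_lt {α : ℝ} (hα : Irrational α) (δ : ℝ) (hδ : 0 < δ) :
    ∃ q : ℕ, 1 ≤ q ∧ q ∉ convDens α ∧ distInt (q * α) < δ := by
  obtain ⟨N, hN⟩ := exists_nat_gt (4 / δ)
  have hb := digit_pos hα
  set n := N + 2
  have hpos := contDen_pos hb n
  refine ⟨2 * contDen (digit α) (n + 1), by omega, two_mul_not_mem_convDens hα (by omega), ?_⟩
  refine (round_le _ (2 * contNum ⌊α⌋ (digit α) (n + 1))).trans_lt ?_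
  push_cast
  have h := inv_two_mul_contDen hα n
  set e := |2 * (contDen (digit α) (n + 1) : ℝ) * α - 2 * contNum ⌊α⌋ (digit α) (n + 1)|
  have h1 : (1 : ℝ) ≤ digit α n := by exact_mod_cast hb n
  have hl := (expansion hα).l_nonneg n
  have hr := (expansion hα).r_pos n
  have hq : (N : ℝ) ≤ contDen (digit α) (n + 1) := by
    exact_mod_cast (show N ≤ n by omega).trans (le_contDen hb n)
  have hN0 : 0 < (N : ℝ) := lt_trans (by positivity) hN
  have h2 : (1 : ℝ) / 4 ≤ (2 * (contDen (digit α) (n + 1) : ℝ) * e)⁻¹ := by rw [h]; linarith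
  have he : 0 < e := by
    refine (abs_nonneg _).lt_of_ne' fun h0 => ?_
    have h0' : e = 0 := h0
    rw [h0'] at h2
    norm_num at h2
  rw [le_inv_comm₀ (by norm_num) (by positivity)] at h2
  rw [div_lt_iff₀ hδ] at hN
  have h3 : (N : ℝ) * e ≤ contDen (digit α) (n + 1) * e := by gcongr
  norm_num at h2
  by_contra! hcon
  have : (N : ℝ) * δ ≤ N * e := by gcongr
  linarith

theorem exists_contDen_le_lt {b : ℕ → ℕ} (hb : ∀ n, 1 ≤ b n) {N q : ℕ}
    (h : contDen b (N + 1) ≤ q) :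
    ∃ n, N ≤ n ∧ contDen b (n + 1) ≤ q ∧ q < contDen b (n + 2) := by
  have hex : ∃ k, q < contDen b (N + k + 2) :=
    ⟨q, by have := le_contDen hb (N + q + 1); simp only [add_assoc, Nat.reduceAdd] at *; omega⟩
  refine ⟨N + Nat.find hex, Nat.le_add_right _ _, ?_, Nat.find_spec hex⟩
  rcases Nat.eq_zero_or_pos (Nat.find hex) with h0 | h0
  · rwa [h0]
  · have := Nat.find_min hex (Nat.sub_lt h0 one_pos)
    rw [not_lt] at this
    rwa [show N + (Nat.find hex - 1) + 2 = N + Nat.find hex + 1 by omega] at this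

/-- Coordinates with respect to two consecutive convergents. -/
theorem exists_coordinates {α : ℝ} (hα : Irrational α) (n : ℕ) (q p : ℤ) :
    ∃ x y : ℤ, q = x * contDen (digit α) (n + 1) + y * contDen (digit α) n ∧
      p = x * contNum ⌊α⌋ (digit α) (n + 1) + y * contNum ⌊α⌋ (digit α) n ∧
      (q : ℝ) = (x + y * leftTail (digit α) n) * contDen (digit α) (n + 1) ∧
      |q * α - p| = |x - y * (digit α n + rightTail α n)| * |err α (n + 1)| := by
  have hd := contNum_mul_sub ⌊α⌋ (digit α) n
  have hs : ((-1 : ℤ) ^ n) * (-1) ^ n = 1 := by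
    rw [← mul_pow]; norm_num
  set Q := (contDen (digit α) n : ℤ)
  set Q' := (contDen (digit α) (n + 1) : ℤ)
  set P := contNum ⌊α⌋ (digit α) n
  set P' := contNum ⌊α⌋ (digit α) (n + 1)
  set s := (-1 : ℤ) ^ n
  have e1 : q = s * (q * P - p * Q) * Q' + s * (p * Q' - q * P') * Q := by
    linear_combination (-q * s) * hd - q * hs
  have e2 : p = s * (q * P - p * Q) * P' + s * (p * Q' - q * P') * P := by
    linear_combination (-p * s) * hd - p * hs
  refine ⟨s * (q * P - p * Q), s * (p * Q' - q * P'), e1, e2, ?_, ?_⟩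
  · have hQ : (0 : ℝ) < contDen (digit α) (n + 1) := by exact_mod_cast contDen_pos (digit_pos hα) n
    have h3 : leftTail (digit α) n * contDen (digit α) (n + 1) = contDen (digit α) n := by
      rw [leftTail]; field_simp
    rw [add_mul, mul_assoc _ (leftTail _ _), h3]
    exact_mod_cast e1
  · have e1' := congrArg (Int.cast : ℤ → ℝ) e1
    have e2' := congrArg (Int.cast : ℤ → ℝ) e2
    rw [← abs_mul]
    congr 1
    have := err_eq hα n
    simp only [err] at this ⊢
    generalize s * (q * P - p * Q) = x at *
    generalize s * (p * Q' - q * P') = y at *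
    push_cast at e1' e2'
    rw [e1', e2']
    simp only [Q, Q', P, P', Int.cast_natCast]
    linear_combination (y : ℝ) * this

/-- The size estimate behind the theorem of Fatou and Grace: outside the multiples of the
convergents and the intermediate fractions, `q ‖q α‖ ≥ 1`. Here `x` and `y` are the coordinates of
`(q, p)` in the basis of two consecutive convergents, `x + y l` is `q` in units of `q_n`, and
`|x - y (b + r)|` is the error in units of `|q_n α - p_n|`, so that the bound to reach is
`b + l + r`. -/
theorem le_mul_abs_of_between {b : ℕ} {l r : ℝ} (hl : 0 ≤ l) (hl1 : l ≤ 1) (hr : 0 < r)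
    {x y : ℤ} (h1 : 1 < x + y * l) (h2 : x + y * l < b + l) :
    (b + l + r ≤ (x + y * l) * |x - y * (b + r)|) ∨ (y = 0 ∧ 2 ≤ x) ∨
      (y = 1 ∧ 1 ≤ x ∧ x < b) := by
  have hb : (0 : ℝ) ≤ b := by positivity
  rcases lt_trichotomy y 0 with hy | rfl | hy
  · left
    have hy' : (y : ℝ) ≤ -1 := by exact_mod_cast (show y ≤ -1 by omega)
    have h3 : b + l + r ≤ |x - y * (b + r)| := (show _ ≤ _ by nlinarith).trans (le_abs_self _)
    nlinarith
  · right; left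
    refine ⟨rfl, ?_⟩
    simp only [Int.cast_zero, zero_mul, add_zero] at h1
    have : 1 < x := by exact_mod_cast h1
    omega
  · rcases (show 1 ≤ y by omega).eq_or_lt with rfl | hy
    · right; right
      simp only [Int.cast_one, one_mul, add_lt_add_iff_right] at h1 h2
      refine ⟨rfl, ?_, by exact_mod_cast h2⟩
      have : (0 : ℝ) < x := by linarith
      have : 0 < x := by exact_mod_cast this
      omega
    · left
      have hy' : (2 : ℝ) ≤ y := by exact_mod_cast hy
      have h3 : b + l + r ≤ |x - y * (b + r)| :=
        (show _ ≤ _ by nlinarith).trans (neg_le_abs _)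
      nlinarith

/-- The sharper estimate at a partial quotient `1`, needed for values of `λ^{[2]}` below `1`. The
exception `x = 0`, `y = 2` is twice the previous convergent. -/
theorem two_mul_le_mul_abs_of_between {l r : ℝ} (hl : 0 ≤ l) (hl1 : l ≤ 2 / 3) (hr : 0 < r)
    (hr1 : r < 1) {x y : ℤ} (h1 : 1 < x + y * l) (h2 : x + y * l < 1 + l) :
    (2 * (1 + l + r) ≤ (x + y * l) * |x - y * (1 + r)|) ∨ (y = 2 ∧ x = 0) := by
  by_cases hy2 : y = 2
  · right
    subst hy2
    push_cast at h1 h2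
    have h3 : (x : ℝ) < 1 := by linarith
    have h4 : (-1 : ℝ) < x := by linarith
    have h3' : x < 1 := by exact_mod_cast h3
    have h4' : -1 < x := by exact_mod_cast h4
    exact ⟨rfl, by omega⟩
  left
  rcases lt_trichotomy y (-1) with hy | rfl | hy
  · have hy' : (y : ℝ) ≤ -2 := by exact_mod_cast (show y ≤ -2 by omega)
    have h3 : 2 * (1 + l + r) ≤ |x - y * (1 + r)| :=
      (show _ ≤ _ by nlinarith).trans (le_abs_self _)
    nlinarith
  · push_cast at h1 h2 ⊢
    have h3 : (x : ℝ) < 3 := by linarith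
    have h4 : (1 : ℝ) < x := by linarith
    have h3' : x < 3 := by exact_mod_cast h3
    have h4' : 1 < x := by exact_mod_cast h4
    obtain rfl : x = 2 := by omega
    push_cast
    rw [abs_of_pos (by linarith)]
    nlinarith
  · rcases (show y = 0 ∨ y = 1 ∨ 3 ≤ y by omega) with rfl | rfl | hy
    · exfalso
      simp only [Int.cast_zero, zero_mul, add_zero] at h1 h2
      have h3 : (x : ℝ) < 2 := by linarith
      have h3' : x < 2 := by exact_mod_cast h3
      have h4' : 1 < x := by exact_mod_cast h1
      omega
    · exfalso
      simp only [Int.cast_one, one_mul, add_lt_add_iff_right] at h1 h2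
      have h4 : (0 : ℝ) < x := by linarith
      have h3' : x < 1 := by exact_mod_cast h2
      have h4' : 0 < x := by exact_mod_cast h4
      omega
    · have hy' : (3 : ℝ) ≤ y := by exact_mod_cast hy
      have h3 : 2 * (1 + l + r) ≤ |x - y * (1 + r)| :=
        (show _ ≤ _ by nlinarith).trans (neg_le_abs _)
      nlinarith

/-- The coordinates of an arbitrary large `q` that is not the denominator of a convergent, and the
value `1 / (q |q α - p|)` in terms of them. -/
theorem exists_between_of_large {α : ℝ} (hα : Irrational α) {N q : ℕ}
    (hq : contDen (digit α) (N + 2) ≤ q) (hc : q ∉ convDens α) (p : ℤ) :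
    ∃ n, N < n ∧ ∃ x y : ℤ, (q : ℤ) = x * contDen (digit α) (n + 1) + y * contDen (digit α) n ∧
      p = x * contNum ⌊α⌋ (digit α) (n + 1) + y * contNum ⌊α⌋ (digit α) n ∧
      1 < x + y * leftTail (digit α) n ∧
      x + y * leftTail (digit α) n < digit α n + leftTail (digit α) n ∧
      (q * |q * α - p|)⁻¹ = (digit α n + leftTail (digit α) n + rightTail α n) /
        ((x + y * leftTail (digit α) n) * |x - y * (digit α n + rightTail α n)|) := by
  have hb := digit_pos hα
  obtain ⟨n, hn, h1, h2⟩ := exists_contDen_le_lt hb (N := N + 1) hq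
  obtain ⟨x, y, e1, e2, e3, e4⟩ := exists_coordinates hα n q p
  refine ⟨n, by omega, x, y, e1, e2, ?_⟩
  have hlt : contDen (digit α) (n + 1) < q := h1.lt_of_ne fun h =>
    hc ((mem_convDens hα q).2 ⟨n + 1, by omega, h.symm⟩)
  have hQ : (0 : ℝ) < contDen (digit α) (n + 1) := by exact_mod_cast contDen_pos hb n
  have h3 : leftTail (digit α) n * contDen (digit α) (n + 1) = contDen (digit α) n := by
    rw [leftTail]; field_simp
  have h4 := abs_err_mul hα n
  push_cast at e3 e4
  refine ⟨?_, ?_, ?_⟩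
  · have : (contDen (digit α) (n + 1) : ℝ) < q := by exact_mod_cast hlt
    rw [e3] at this
    exact (lt_mul_iff_one_lt_left hQ).1 this
  · have : (q : ℝ) < contDen (digit α) (n + 2) := by exact_mod_cast h2
    rw [e3, contDen_add_two] at this
    push_cast at this
    rw [← h3, ← add_mul] at this
    exact (mul_lt_mul_iff_left₀ hQ).1 this
  · rw [e3] at e4 ⊢
    rw [e4]
    have h5 : (|err α (n + 1)| * contDen (digit α) (n + 1) : ℝ) ≠ 0 := by
      intro h0
      rw [h0, zero_mul] at h4
      exact zero_ne_one h4
    rw [inv_eq_one_div, ← h4]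
    have h6 : |err α (n + 1)| ≠ 0 := left_ne_zero_of_mul h5
    by_cases h7 : (x + y * leftTail (digit α) n) = 0
    · simp [h7]
    by_cases h8 : |x - y * (digit α n + rightTail α n)| = 0
    · simp [h8]
    field_simp

/-- The upper bound for values of `λ^{[2]}` that are at least `1`. -/
theorem lambda2_le_of_eventually {α L : ℝ} (hα : Irrational α) (hL : 1 ≤ L)
    (h : ∀ᶠ n in atTop, (digit α n + leftTail (digit α) n + rightTail α n) / 4 ≤ L ∧
      ∀ c : ℕ, 1 ≤ c → c < digit α n →
        1 / (c + leftTail (digit α) n) + 1 / (digit α n - c + rightTail α n) ≤ L) :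
    lambda2 α ≤ (L : EReal) := by
  obtain ⟨N, hN⟩ := eventually_atTop.1 h
  refine lambda2_le hα (contDen (digit α) (N + 2)) (fun q hq h1 hc => ?_) (exists_distInt_lt hα)
  obtain ⟨n, hn, x, y, -, -, hx1, hx2, he⟩ := exists_between_of_large hα hq hc (round (q * α))
  obtain ⟨g1, g2⟩ := hN n hn.le
  have hE := expansion hα
  have hl := hE.l_nonneg n
  have hr := hE.r_pos n
  have hb1 : (1 : ℝ) ≤ digit α n := by exact_mod_cast hE.one_le n
  rw [distInt, he]
  rcases le_mul_abs_of_between hl (hE.l_le_one n) hr hx1 hx2 with h3 | ⟨rfl, h3⟩ | ⟨rfl, h3, h4⟩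
  · exact (div_le_one_of_le₀ h3 (by positivity)).trans hL
  · refine le_trans ?_ g1
    have h3' : (2 : ℝ) ≤ x := by exact_mod_cast h3
    simp only [Int.cast_zero, zero_mul, add_zero, sub_zero]
    gcongr
    nlinarith [le_abs_self (x : ℝ)]
  · lift x to ℕ using by omega
    have h3' : 1 ≤ x := by omega
    have h4' : x < digit α n := by omega
    refine le_trans (le_of_eq ?_) (g2 x h3' h4')
    have h4'' : (x : ℝ) < digit α n := by exact_mod_cast h4'
    have hx0 : (1 : ℝ) ≤ x := by exact_mod_cast h3'
    simp only [Int.cast_one, one_mul, Int.cast_natCast]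
    rw [abs_of_neg (by linarith), div_add_div _ _ (by positivity) (by linarith)]
    congr 1 <;> ring

/-- The upper bound for numbers whose partial quotients are eventually `1`. -/
theorem lambda2_le_of_eventually_eq_one {α L : ℝ} (hα : Irrational α) (hL : 1 / 2 ≤ L)
    (h : ∀ᶠ n in atTop, digit α n = 1 ∧
      (digit α n + leftTail (digit α) n + rightTail α n) / 4 ≤ L) :
    lambda2 α ≤ (L : EReal) := by
  obtain ⟨N, hN⟩ := eventually_atTop.1 h
  have hE := expansion hα
  refine lambda2_le hα (contDen (digit α) (N + 3)) (fun q hq h1 hc => ?_) (exists_distInt_lt hα)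
  obtain ⟨n, hn, x, y, e1, e2, hx1, hx2, he⟩ :=
    exists_between_of_large (N := N + 1) hα hq hc (round (q * α))
  have hb := (hN n (by omega)).1
  obtain ⟨n, rfl⟩ := Nat.exists_eq_add_of_le' (show 2 ≤ n by omega)
  rw [hb] at hx2
  simp only [Nat.cast_one] at hx2
  have hl23 : leftTail (digit α) (n + 2) ≤ 2 / 3 := by
    have h0 := hE.l_nonneg n
    have h0' := hE.l_le_one n
    rw [hE.l_succ (n + 1), hE.l_succ n, (hN (n + 1) (by omega)).1, (hN n (by omega)).1,
      div_le_div_iff₀ (by positivity) (by norm_num)]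
    have : 1 / 2 ≤ 1 / ((1 : ℕ) + leftTail (digit α) n) := by
      push_cast
      exact one_div_le_one_div_of_le (by linarith) (by linarith)
    push_cast at *
    linarith
  rcases two_mul_le_mul_abs_of_between (hE.l_nonneg _) hl23 (hE.r_pos _) (hE.r_lt_one _) hx1 hx2
    with h3 | ⟨rfl, rfl⟩
  · rw [distInt, he, hb]
    have hl := hE.l_nonneg (n + 2)
    have hr := hE.r_pos (n + 2)
    simp only [Nat.cast_one]
    refine le_trans ?_ hL
    rw [div_le_div_iff₀ (by nlinarith) (by norm_num)]
    linarith
  · refine le_trans (le_of_eq ?_) (hN (n + 1) (by omega)).2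
    rw [← inv_two_mul_contDen hα, distInt, e2]
    have e1' := congrArg (Int.cast : ℤ → ℝ) e1
    push_cast at e1' ⊢
    rw [e1']
    simp [add_assoc]

/-! ### The words `1, 1, 3` and `1, 1, 1, 1, 3` as Möbius maps -/

/-- The Möbius map `z ↦ [0; 1, 1, 3 + z]`. -/
def shortGap (z : ℝ) : ℝ := (4 + z) / (7 + 2 * z)

/-- The Möbius map `z ↦ [0; 1, 1, 1, 1, 3 + z]`. -/
def longGap (z : ℝ) : ℝ := (11 + 3 * z) / (18 + 5 * z)

/-- The fixed point `η = [0; 1, 1, 3, 1, 1, 3, …]` of `shortGap`. -/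
def eta : ℝ := (√17 - 3) / 2

theorem eta_sq : eta ^ 2 = 2 - 3 * eta := by
  have h := Real.sq_sqrt (show (0 : ℝ) ≤ 17 by norm_num)
  rw [eta]
  linear_combination h / 4

theorem eta_gt : 0.5615 < eta := by
  have h : 4.123 < √17 := Real.lt_sqrt_of_sq_lt (by norm_num)
  rw [eta]; linarith

theorem eta_lt : eta < 0.5616 := by
  have h : √17 < 4.1232 := (Real.sqrt_lt' (by norm_num)).2 (by norm_num)
  rw [eta]; linarith

theorem lamInf_eq : lamInf = (3 * eta + 15) / 16 := by
  rw [lamInf, eta]; ring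

theorem longGap_eta : longGap eta = (3 - eta) / 4 := by
  have := eta_gt
  rw [longGap, div_eq_div_iff (by positivity) (by norm_num)]
  linear_combination 5 * eta_sq

theorem longGap_sub {x y : ℝ} (hx : 0 ≤ x) (hy : 0 ≤ y) :
    longGap x - longGap y = -(x - y) / ((18 + 5 * x) * (18 + 5 * y)) := by
  rw [longGap, longGap]
  field_simp
  ring

theorem shortGap_sub {x y : ℝ} (hx : 0 ≤ x) (hy : 0 ≤ y) :
    shortGap x - shortGap y = -(x - y) / ((7 + 2 * x) * (7 + 2 * y)) := by
  rw [shortGap, shortGap]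
  field_simp
  ring

theorem shortGap_mem {z : ℝ} (hz : z ∈ Set.Icc (0 : ℝ) 1) : shortGap z ∈ Set.Icc (0 : ℝ) 1 := by
  obtain ⟨h0, h1⟩ := hz
  rw [shortGap]
  exact ⟨by positivity, by rw [div_le_one (by positivity)]; linarith⟩

theorem longGap_mem {z : ℝ} (hz : z ∈ Set.Icc (0 : ℝ) 1) :
    longGap z ∈ Set.Icc (14 / 23 : ℝ) (11 / 18) := by
  obtain ⟨h0, h1⟩ := hz
  rw [longGap]
  constructor
  · rw [div_le_div_iff₀ (by norm_num) (by positivity)]; linarith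
  · rw [div_le_div_iff₀ (by positivity) (by norm_num)]; linarith

theorem iterate_shortGap_mem {z : ℝ} (hz : z ∈ Set.Icc (0 : ℝ) 1) (m : ℕ) :
    shortGap^[m] z ∈ Set.Icc (0 : ℝ) 1 := by
  induction m with
  | zero => exact hz
  | succ m ih => rw [Function.iterate_succ_apply']; exact shortGap_mem ih

/-- The coordinate on the projective line that puts the two fixed points of `shortGap` at `0`
and `∞`, so that `shortGap` becomes a multiplication. -/
def linCoord (z : ℝ) : ℝ := (z - eta) / (z + eta + 3)

/-- Minus the multiplier of `shortGap` at its fixed point `eta`. -/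
def mult : ℝ := (2 * eta - 1) / (7 + 2 * eta)

theorem mult_pos : 0 < mult := by
  have := eta_gt
  exact div_pos (by linarith) (by linarith)

theorem mult_lt : mult < 1 / 60 := by
  have := eta_gt
  have := eta_lt
  rw [mult, div_lt_div_iff₀ (by linarith) (by norm_num)]
  linarith

theorem linCoord_shortGap {z : ℝ} (hz : 0 ≤ z) :
    linCoord (shortGap z) = -mult * linCoord z := by
  have h := eta_gt
  have h1 : shortGap z - eta = (1 - 2 * eta) * (z - eta) / (7 + 2 * z) := by
    rw [shortGap]
    field_simp
    linear_combination (-2) * eta_sq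
  have h2 : shortGap z + eta + 3 = (7 + 2 * eta) * (z + eta + 3) / (7 + 2 * z) := by
    rw [shortGap]
    field_simp
    linear_combination (-2) * eta_sq
  rw [linCoord, h1, h2, linCoord, mult]
  have : 0 < z + eta + 3 := by linarith
  have : 0 < 7 + 2 * eta := by linarith
  field_simp
  ring

theorem linCoord_iterate {z : ℝ} (hz : z ∈ Set.Icc (0 : ℝ) 1) (m : ℕ) :
    linCoord (shortGap^[m] z) = (-mult) ^ m * linCoord z := by
  induction m with
  | zero => simp
  | succ m ih =>
    rw [Function.iterate_succ_apply', linCoord_shortGap (iterate_shortGap_mem hz m).1, ih]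
    ring

theorem sub_eta_eq {z : ℝ} (hz : 0 ≤ z) : z - eta = linCoord z * (z + eta + 3) := by
  have := eta_gt
  rw [linCoord, div_mul_cancel₀ _ (by linarith)]

/-- The range of `linCoord` on the values of `longGap`; it is positive and narrow. -/
theorem linCoord_bounds {s : ℝ} (hs : s ∈ Set.Icc (14 / 23 : ℝ) (11 / 18)) :
    linCoord s ∈ Set.Icc (0.011 : ℝ) 0.012 := by
  obtain ⟨h0, h1⟩ := hs
  have := eta_gt
  have := eta_lt
  rw [linCoord]
  constructor
  · rw [le_div_iff₀ (by linarith)]; norm_num at *; linarith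
  · rw [div_le_iff₀ (by linarith)]; norm_num at *; linarith

/-- Two deviations from `eta` on the two sides of a long gap cannot compensate each other. -/
theorem lt_eta_of_longGap_add_lt {z₁ z₂ : ℝ} (h1 : 0 ≤ z₁) (h2 : 0 ≤ z₂)
    (hA : longGap z₁ + z₂ < longGap eta + eta) (hB : longGap z₂ + z₁ < longGap eta + eta) :
    z₁ < eta := by
  by_contra! hc
  have he := eta_gt
  have key : ∀ x : ℝ, 0 ≤ x →
      longGap x - longGap eta = -(x - eta) / ((18 + 5 * x) * (18 + 5 * eta)) :=
    fun x hx => longGap_sub hx (by linarith)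
  have k1 := key z₁ h1
  have k2 := key z₂ h2
  have b1 : (324 : ℝ) ≤ (18 + 5 * z₁) * (18 + 5 * eta) := by nlinarith
  have b2 : (324 : ℝ) ≤ (18 + 5 * z₂) * (18 + 5 * eta) := by nlinarith
  rw [eq_div_iff (by linarith)] at k1 k2
  -- the deviation of `z₂` must be positive, and then each deviation exceeds `324` times the other
  have c2 : 0 < z₂ - eta := by
    by_contra! hc2
    nlinarith
  have : 324 * (z₁ - eta) < z₂ - eta := by
    have : z₁ - eta < longGap eta - longGap z₂ := by linarith
    nlinarith
  have : 324 * (z₂ - eta) < z₁ - eta := by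
    have : z₂ - eta < longGap eta - longGap z₁ := by linarith
    nlinarith
  linarith

/-- The runs of short gaps on the two sides of a long gap: if both values at this gap are below
`λ_∞`, then both runs have odd length, and the left one is at most one longer than the right one. -/
theorem odd_and_le_of_longGap_add_lt {s₁ s₂ : ℝ} {m₁ m₂ : ℕ}
    (hs₁ : s₁ ∈ Set.Icc (14 / 23 : ℝ) (11 / 18)) (hs₂ : s₂ ∈ Set.Icc (14 / 23 : ℝ) (11 / 18))
    (hA : longGap (shortGap^[m₁] s₁) + shortGap^[m₂] s₂ < longGap eta + eta)
    (hB : longGap (shortGap^[m₂] s₂) + shortGap^[m₁] s₁ < longGap eta + eta) :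
    Odd m₁ ∧ Odd m₂ ∧ m₁ ≤ m₂ + 1 := by
  have hI : Set.Icc (14 / 23 : ℝ) (11 / 18) ⊆ Set.Icc 0 1 :=
    Set.Icc_subset_Icc (by norm_num) (by norm_num)
  have he := eta_gt
  have he' := eta_lt
  have hk := mult_pos
  have hk' := mult_lt
  have w₁ := linCoord_iterate (hI hs₁) m₁
  have w₂ := linCoord_iterate (hI hs₂) m₂
  obtain ⟨a1, a2⟩ := iterate_shortGap_mem (hI hs₁) m₁
  obtain ⟨c1, c2⟩ := iterate_shortGap_mem (hI hs₂) m₂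
  obtain ⟨p1, p2⟩ := linCoord_bounds hs₁
  obtain ⟨q1, q2⟩ := linCoord_bounds hs₂
  set z₁ := shortGap^[m₁] s₁
  set z₂ := shortGap^[m₂] s₂
  have d1 := lt_eta_of_longGap_add_lt a1 c1 hA hB
  have d2 := lt_eta_of_longGap_add_lt c1 a1 hB hA
  have e1 := sub_eta_eq a1
  have e2 := sub_eta_eq c1
  have n1 : linCoord z₁ < 0 := by nlinarith
  have n2 : linCoord z₂ < 0 := by nlinarith
  have o1 : Odd m₁ := by
    by_contra hodd
    rw [Nat.not_odd_iff_even] at hodd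
    rw [w₁, hodd.neg_pow] at n1
    have := pow_pos hk m₁
    nlinarith
  have o2 : Odd m₂ := by
    by_contra hodd
    rw [Nat.not_odd_iff_even] at hodd
    rw [w₂, hodd.neg_pow] at n2
    have := pow_pos hk m₂
    nlinarith
  refine ⟨o1, o2, ?_⟩
  by_contra! hlt
  -- the slope of `longGap` is at least `1 / 23²`, so the deviation of `z₂` is less than `529` times
  -- that of `z₁`, whereas two more short gaps shrink a deviation by the factor `mult² ≤ 1 / 3600`
  rw [o1.neg_pow] at w₁
  rw [o2.neg_pow] at w₂
  have k2 := longGap_sub c1 (show 0 ≤ eta by linarith)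
  have b2 : (18 + 5 * z₂) * (18 + 5 * eta) ≤ 23 * 23 := by
    apply mul_le_mul <;> linarith
  have b2' : 0 < (18 + 5 * z₂) * (18 + 5 * eta) := by
    apply mul_pos <;> linarith
  rw [eq_div_iff b2'.ne'] at k2
  have r : (eta - z₂) < 529 * (eta - z₁) := by
    have h : longGap z₂ - longGap eta < eta - z₁ := by linarith
    have h' := mul_lt_mul_of_pos_right h b2'
    have h'' := mul_le_mul_of_nonneg_left b2 (show 0 ≤ eta - z₁ by linarith)
    linarith
  have r' : -linCoord z₂ < 690 * -linCoord z₁ := by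
    have f1 := mul_le_mul_of_nonneg_left (show (3.56 : ℝ) ≤ z₂ + eta + 3 by linarith)
      (show 0 ≤ -linCoord z₂ by linarith)
    have f2 := mul_le_mul_of_nonneg_left (show z₁ + eta + 3 ≤ (4.57 : ℝ) by linarith)
      (show 0 ≤ -linCoord z₁ by linarith)
    linarith
  have hpow : mult ^ m₁ ≤ mult ^ m₂ / 3600 := by
    have h1 : mult ^ m₁ ≤ mult ^ (m₂ + 2) :=
      pow_le_pow_of_le_one hk.le (by linarith) (by omega)
    have h2 : mult ^ 2 ≤ 1 / 3600 := by nlinarith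
    have h3 := mul_le_mul_of_nonneg_left h2 (pow_pos hk m₂).le
    rw [pow_add] at h1
    linarith
  have hP := pow_pos hk m₂
  have g1 := mul_le_mul_of_nonneg_left q1 hP.le
  have g2 := mul_le_mul_of_nonneg_left p2 (pow_pos hk m₁).le
  rw [w₁, w₂] at r'
  linarith

/-- By symmetry and parity the two runs have the same length. -/
theorem eq_of_longGap_add_lt {s₁ s₂ : ℝ} {m₁ m₂ : ℕ}
    (hs₁ : s₁ ∈ Set.Icc (14 / 23 : ℝ) (11 / 18)) (hs₂ : s₂ ∈ Set.Icc (14 / 23 : ℝ) (11 / 18))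
    (hA : longGap (shortGap^[m₁] s₁) + shortGap^[m₂] s₂ < longGap eta + eta)
    (hB : longGap (shortGap^[m₂] s₂) + shortGap^[m₁] s₁ < longGap eta + eta) :
    Odd m₁ ∧ m₁ = m₂ := by
  obtain ⟨⟨i, hi⟩, ⟨j, hj⟩, h⟩ := odd_and_le_of_longGap_add_lt hs₁ hs₂ hA hB
  obtain ⟨-, -, h'⟩ := odd_and_le_of_longGap_add_lt hs₂ hs₁ hB hA
  exact ⟨⟨i, hi⟩, by omega⟩

/-! ### The partial quotients when all values stay below `λ_∞` -/

/-- The values at the `n`-th partial quotient, one from twice a convergent and the others from the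
intermediate fractions, are all less than `λ_∞`. -/
def BelowAt (b : ℕ → ℕ) (l r : ℕ → ℝ) (n : ℕ) : Prop :=
  (b n + l n + r n) / 4 < lamInf ∧
    ∀ c : ℕ, 1 ≤ c → c < b n → 1 / (c + l n) + 1 / (b n - c + r n) < lamInf

/-- A partial quotient `3`, followed by the word `1, 1, 3`. -/
def IsShort (b : ℕ → ℕ) (n : ℕ) : Prop :=
  b n = 3 ∧ b (n + 1) = 1 ∧ b (n + 2) = 1 ∧ b (n + 3) = 3

/-- A partial quotient `3`, followed by the word `1, 1, 1, 1, 3`. -/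
def IsLong (b : ℕ → ℕ) (n : ℕ) : Prop :=
  b n = 3 ∧ b (n + 1) = 1 ∧ b (n + 2) = 1 ∧ b (n + 3) = 1 ∧ b (n + 4) = 1 ∧ b (n + 5) = 3

theorem lamInf_lt : lamInf < 2607 / 2500 := by
  have := eta_lt
  rw [lamInf_eq]; norm_num at *; linarith

theorem one_div_add_mem {a : ℕ} {u p q : ℝ} (h1 : 1 ≤ a) (h3 : a ≤ 3) (hp : 0 ≤ p)
    (hu : u ∈ Set.Icc p q) : 1 / (a + u) ∈ Set.Icc (1 / (3 + q)) (1 / (1 + p)) := by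
  have h1' : (1 : ℝ) ≤ a := by exact_mod_cast h1
  have h3' : (a : ℝ) ≤ 3 := by exact_mod_cast h3
  obtain ⟨hu1, hu2⟩ := hu
  exact ⟨one_div_le_one_div_of_le (by linarith) (by linarith),
    one_div_le_one_div_of_le (by linarith) (by linarith)⟩

section Bounds

variable {b : ℕ → ℕ} {l r : ℕ → ℝ}

/-- No partial quotient exceeds `4`; next to a `4` both tails are then at least `1 / 5`, which is
too much for a `4` as well. -/
theorem Expansion.le_three (E : Expansion b l r) (H : ∀ n, BelowAt b l r n) (n : ℕ) :
    b (n + 1) ≤ 3 := by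
  have hlam := lamInf_lt
  have h4 : ∀ n, b n ≤ 4 := by
    intro n
    by_contra! h
    have h5 : (5 : ℝ) ≤ b n := by exact_mod_cast h
    have := (H n).1
    have := E.l_nonneg n
    have := E.r_pos n
    linarith
  by_contra! h
  have h5 : (4 : ℝ) ≤ b (n + 1) := by exact_mod_cast h
  have h6 : (b n : ℝ) ≤ 4 := by exact_mod_cast h4 n
  have h7 : (1 : ℝ) ≤ b n := by exact_mod_cast E.one_le n
  have h8 := (H (n + 1)).1
  have h9 := E.r_pos (n + 1)
  have h10 : 1 / (4 + 1) ≤ 1 / (b n + l n) :=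
    one_div_le_one_div_of_le (by linarith [E.l_nonneg n]) (by linarith [E.l_le_one n])
  rw [← E.l_succ] at h10
  linarith

theorem Expansion.tails_mem (E : Expansion b l r) (h3 : ∀ n, b n ≤ 3) (n : ℕ) :
    l (n + 2) ∈ Set.Icc (1 / 4 : ℝ) (4 / 5) ∧ r n ∈ Set.Icc (1 / 4 : ℝ) (4 / 5) := by
  have hl : ∀ n, l (n + 1) ∈ Set.Icc (1 / 4 : ℝ) 1 := fun n => by
    have := one_div_add_mem (E.one_le n) (h3 n) le_rfl ⟨E.l_nonneg n, E.l_le_one n⟩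
    rw [← E.l_succ] at this
    norm_num at *; exact this
  have hr : ∀ n, r n ∈ Set.Icc (1 / 4 : ℝ) 1 := fun n => by
    have := one_div_add_mem (E.one_le (n + 1)) (h3 (n + 1)) le_rfl
      ⟨(E.r_pos (n + 1)).le, (E.r_lt_one (n + 1)).le⟩
    rw [← E.r_eq] at this
    norm_num at *; exact this
  constructor
  · have := one_div_add_mem (E.one_le (n + 1)) (h3 (n + 1)) (by norm_num) (hl n)
    rw [← E.l_succ] at this
    norm_num at *; exact this
  · have := one_div_add_mem (E.one_le (n + 1)) (h3 (n + 1)) (by norm_num) (hr (n + 1))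
    rw [← E.r_eq] at this
    norm_num at *; exact this

/-- A partial quotient `2` would have both tails at most `4 / 5`, and `2 / (1 + 4 / 5) > λ_∞`. -/
theorem Expansion.eq_one_or_three (E : Expansion b l r) (h3 : ∀ n, b n ≤ 3)
    (H : ∀ n, BelowAt b l r n) (n : ℕ) : b (n + 2) = 1 ∨ b (n + 2) = 3 := by
  have h1 := E.one_le (n + 2)
  have h2 := h3 (n + 2)
  by_contra! hne
  have he : b (n + 2) = 2 := by omega
  have h := (H (n + 2)).2 1 le_rfl (by omega)
  obtain ⟨-, hl⟩ := (E.tails_mem h3 n).1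
  obtain ⟨-, hr⟩ := (E.tails_mem h3 (n + 2)).2
  rw [he] at h
  push_cast at h
  have := E.l_nonneg (n + 2)
  have := E.r_pos (n + 2)
  have e1 : 1 / (1 + 4 / 5) ≤ 1 / (1 + l (n + 2)) :=
    one_div_le_one_div_of_le (by linarith) (by linarith)
  have e2 : 1 / (1 + 4 / 5) ≤ 1 / (2 - 1 + r (n + 2)) :=
    one_div_le_one_div_of_le (by linarith) (by linarith)
  have := lamInf_lt
  linarith

end Bounds

/-- Both neighbours of a partial quotient `3` equal `1`. -/
theorem first_eq_one {a : ℕ} {x u y : ℝ} (ha : a = 1 ∨ a = 3) (hx : x = 1 / (a + u)) (hu : 0 ≤ u)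
    (hy0 : 0 ≤ y) (hy : y ≤ 4 / 5) (h : 1 / (1 + x) + 1 / (2 + y) < lamInf) : a = 1 := by
  refine ha.resolve_right ?_
  rintro rfl
  have hx0 : 0 ≤ x := by rw [hx]; positivity
  have hx1 : x ≤ 1 / 3 := by
    rw [hx]; push_cast; exact one_div_le_one_div_of_le (by norm_num) (by linarith)
  have e1 : 1 / (1 + 1 / 3) ≤ 1 / (1 + x) := one_div_le_one_div_of_le (by linarith) (by linarith)
  have e2 : 1 / (2 + 4 / 5) ≤ 1 / (2 + y) := one_div_le_one_div_of_le (by linarith) (by linarith)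
  have := lamInf_lt
  linarith

/-- Next to `3, 1` there is another `1`. -/
theorem second_eq_one {a : ℕ} {x t u y : ℝ} (ha : a = 1 ∨ a = 3) (hx : x = 1 / (1 + t))
    (ht : t = 1 / (a + u)) (hu : 0 ≤ u) (hy : 5 / 9 ≤ y) (h : (3 + x + y) / 4 < lamInf) :
    a = 1 := by
  refine ha.resolve_right ?_
  rintro rfl
  have ht0 : 0 ≤ t := by rw [ht]; positivity
  have ht1 : t ≤ 1 / 3 := by
    rw [ht]; push_cast; exact one_div_le_one_div_of_le (by norm_num) (by linarith)
  have e1 : 1 / (1 + 1 / 3) ≤ 1 / (1 + t) := one_div_le_one_div_of_le (by linarith) (by linarith)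
  have := lamInf_lt
  rw [← hx] at e1
  linarith

/-- The word that follows `3, 1, 1` is `3` or `1, 1, 3`. -/
theorem third_cases {a₃ a₄ a₅ : ℕ} {x t₁ t₂ t₃ t₄ t₅ y : ℝ} (h₃ : a₃ = 1 ∨ a₃ = 3)
    (h₄ : a₄ = 1 ∨ a₄ = 3) (h₅ : a₅ = 1 ∨ a₅ = 3) (hx : x = 1 / (1 + t₁)) (e₁ : t₁ = 1 / (1 + t₂))
    (e₂ : t₂ = 1 / (a₃ + t₃)) (e₃ : t₃ = 1 / (a₄ + t₄)) (e₄ : t₄ = 1 / (a₅ + t₅)) (h0 : 0 ≤ t₅)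
    (h1 : t₅ ≤ 4 / 5) (hy : 24 / 43 ≤ y) (h : (3 + x + y) / 4 < lamInf) :
    a₃ = 3 ∨ (a₃ = 1 ∧ a₄ = 1 ∧ a₅ = 3) := by
  rcases h₃ with rfl | rfl
  swap
  · exact Or.inl rfl
  right
  have p4 : 0 ≤ t₄ := by rw [e₄]; positivity
  have p3 : 0 ≤ t₃ := by rw [e₃]; positivity
  have p2 : 0 ≤ t₂ := by rw [e₂]; positivity
  have hlam := lamInf_lt
  have hx' : x = (1 + t₂) / (2 + t₂) := by
    rw [hx, e₁]; field_simp; ring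
  have hx1 : x ≤ 0.61307 := by linarith
  have ht2 : t₂ ≤ 0.585 := by
    rw [hx', div_le_iff₀ (by linarith)] at hx1
    linarith
  have ht3 : 0.709 ≤ t₃ := by
    rw [e₂, div_le_iff₀ (by positivity)] at ht2
    push_cast at ht2
    linarith
  have ha4 : a₄ = 1 := by
    refine h₄.resolve_right ?_
    rintro rfl
    have : t₃ ≤ 1 / 3 := by
      rw [e₃]; push_cast; exact one_div_le_one_div_of_le (by norm_num) (by linarith)
    linarith
  subst ha4
  refine ⟨rfl, rfl, h₅.resolve_left ?_⟩
  rintro rfl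
  have h5 : 1 / (1 + 4 / 5) ≤ t₄ := by
    rw [e₄]; push_cast; exact one_div_le_one_div_of_le (by linarith) (by linarith)
  have h6 : t₃ ≤ 1 / (1 + 5 / 9) := by
    rw [e₃]; push_cast; exact one_div_le_one_div_of_le (by norm_num) (by linarith)
  linarith

section Structure

variable {b : ℕ → ℕ} {l r : ℕ → ℝ}

theorem Expansion.l_shortGap (E : Expansion b l r) {n : ℕ} (h0 : b n = 3) (h1 : b (n + 1) = 1)
    (h2 : b (n + 2) = 1) : l (n + 3) = shortGap (l n) := by
  have := E.l_nonneg n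
  rw [E.l_succ (n + 2), E.l_succ (n + 1), E.l_succ n, h0, h1, h2, shortGap]
  push_cast
  field_simp
  ring

theorem Expansion.l_longGap (E : Expansion b l r) {n : ℕ} (h : IsLong b n) :
    l (n + 5) = longGap (l n) := by
  obtain ⟨h0, h1, h2, h3, h4, -⟩ := h
  have := E.l_nonneg n
  rw [E.l_succ (n + 4), E.l_succ (n + 3), E.l_succ (n + 2), E.l_succ (n + 1), E.l_succ n, h0, h1,
    h2, h3, h4, longGap]
  push_cast
  field_simp
  ring

theorem Expansion.r_shortGap (E : Expansion b l r) {n : ℕ} (h : IsShort b n) :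
    r n = shortGap (r (n + 3)) := by
  obtain ⟨-, h1, h2, h3⟩ := h
  have := E.r_pos (n + 3)
  rw [E.r_eq n, E.r_eq (n + 1), E.r_eq (n + 2), h1, h2, h3, shortGap]
  push_cast
  field_simp
  ring

theorem Expansion.r_longGap (E : Expansion b l r) {n : ℕ} (h : IsLong b n) :
    r n = longGap (r (n + 5)) := by
  obtain ⟨-, h1, h2, h3, h4, h5⟩ := h
  have := E.r_pos (n + 5)
  rw [E.r_eq n, E.r_eq (n + 1), E.r_eq (n + 2), E.r_eq (n + 3), E.r_eq (n + 4), h1, h2, h3, h4,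
    h5, longGap]
  push_cast
  field_simp
  ring

theorem Expansion.l_iterate (E : Expansion b l r) {n m : ℕ} (h : ∀ j < m, IsShort b (n + 3 * j)) :
    l (n + 3 * m) = shortGap^[m] (l n) := by
  induction m with
  | zero => rfl
  | succ m ih =>
    obtain ⟨h0, h1, h2, -⟩ := h m (by omega)
    rw [Function.iterate_succ_apply', ← ih fun j hj => h j (by omega)]
    exact E.l_shortGap h0 h1 h2

theorem Expansion.r_iterate (E : Expansion b l r) {n m : ℕ} (h : ∀ j < m, IsShort b (n + 3 * j)) :
    r n = shortGap^[m] (r (n + 3 * m)) := by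
  induction m with
  | zero => rfl
  | succ m ih =>
    rw [Function.iterate_succ_apply, ih fun j hj => h j (by omega),
      E.r_shortGap (h m (by omega))]
    rfl

theorem BelowAt.values_of_three {n : ℕ} (H : BelowAt b l r n) (h : b n = 3) :
    (3 + l n + r n) / 4 < lamInf ∧ 1 / (1 + l n) + 1 / (2 + r n) < lamInf ∧
      1 / (1 + r n) + 1 / (2 + l n) < lamInf := by
  have h1 := H.1
  have h2 := H.2 1 le_rfl (by omega)
  have h3 := H.2 2 (by omega) (by omega)
  rw [h] at h1 h2 h3
  norm_num at h1 h2 h3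
  norm_num
  exact ⟨h1, h2, by rw [add_comm]; exact h3⟩

/-- Between consecutive partial quotients `3` there are two or four `1`s. -/
theorem Expansion.isShort_or_isLong (E : Expansion b l r) (h13 : ∀ n, b n = 1 ∨ b n = 3)
    (H : ∀ n, BelowAt b l r n) (n : ℕ) (h : b (n + 5) = 3) :
    IsShort b (n + 5) ∨ IsLong b (n + 5) := by
  have h3 : ∀ n, b n ≤ 3 := fun n => by rcases h13 n with h | h <;> omega
  obtain ⟨g1, g2, g3⟩ := (H (n + 5)).values_of_three h
  have g1' : (3 + r (n + 5) + l (n + 5)) / 4 < lamInf := by linarith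
  have T := E.tails_mem h3
  have el : l (n + 5) = 1 / (b (n + 4) + l (n + 4)) := E.l_succ (n + 4)
  have er : r (n + 5) = 1 / (b (n + 6) + r (n + 6)) := E.r_eq (n + 5)
  have hl1 : b (n + 4) = 1 := first_eq_one (h13 _) el (E.l_nonneg _)
    (E.r_pos _).le (T (n + 5)).2.2 g2
  have hr1 : b (n + 6) = 1 := first_eq_one (h13 _) er (E.r_pos _).le
    (E.l_nonneg _) (T (n + 3)).1.2 g3
  rw [hl1, Nat.cast_one] at el
  rw [hr1, Nat.cast_one] at er
  have pl : 0 ≤ l (n + 4) := E.l_nonneg _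
  have pr : 0 < r (n + 6) := E.r_pos _
  have yl : 5 / 9 ≤ l (n + 5) := by
    rw [el, show (5 / 9 : ℝ) = 1 / (1 + 4 / 5) by norm_num]
    exact one_div_le_one_div_of_le (by linarith) (by linarith [(T (n + 2)).1.2])
  have yr : 5 / 9 ≤ r (n + 5) := by
    rw [er, show (5 / 9 : ℝ) = 1 / (1 + 4 / 5) by norm_num]
    exact one_div_le_one_div_of_le (by linarith) (by linarith [(T (n + 6)).2.2])
  have el2 : l (n + 4) = 1 / (b (n + 3) + l (n + 3)) := E.l_succ (n + 3)
  have er2 : r (n + 6) = 1 / (b (n + 7) + r (n + 7)) := E.r_eq (n + 6)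
  have hl2 : b (n + 3) = 1 := second_eq_one (h13 _) el el2 (E.l_nonneg _) yr g1
  have hr2 : b (n + 7) = 1 := second_eq_one (h13 _) er er2 (E.r_pos _).le yl g1'
  rw [hl2, Nat.cast_one] at el2
  rw [hr2, Nat.cast_one] at er2
  have yl2 : 24 / 43 ≤ l (n + 5) := by
    have e := (one_div_add_mem (E.one_le (n + 2)) (h3 (n + 2)) (by norm_num) (T n).1).1
    rw [← E.l_succ] at e
    have e1 : 1 / (1 + l (n + 3)) ≤ 1 / (1 + 5 / 19) :=
      one_div_le_one_div_of_le (by norm_num) (by norm_num at e; linarith)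
    rw [el, show (24 / 43 : ℝ) = 1 / (1 + 1 / (1 + 5 / 19)) by norm_num]
    rw [← el2] at e1
    exact one_div_le_one_div_of_le (by linarith) (by linarith)
  rcases third_cases (h13 (n + 8)) (h13 (n + 9)) (h13 (n + 10)) er er2 (E.r_eq (n + 7))
    (E.r_eq (n + 8)) (E.r_eq (n + 9)) (E.r_pos _).le (T (n + 10)).2.2 yl2 g1'
    with h8 | ⟨h8, h9, h10⟩
  · exact Or.inl ⟨h, hr1, hr2, h8⟩
  · exact Or.inr ⟨h, hr1, hr2, h8, h9, h10⟩

/-- The facts about the partial quotients that are needed to cut them into blocks. The first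
partial quotients are excluded because the left tails there depend on the arbitrary `l 0`. -/
theorem Expansion.eventually_gaps (E : Expansion b l r) (H : ∀ n, BelowAt b l r n) (n : ℕ)
    (hn : 8 ≤ n) : (b n = 1 ∨ b n = 3) ∧ (b n = 3 → IsShort b n ∨ IsLong b n) := by
  obtain ⟨n, rfl⟩ := Nat.exists_eq_add_of_le hn
  have E1 := E.shift 1
  have H1 : ∀ n, BelowAt (fun n => b (1 + n)) (fun n => l (1 + n)) (fun n => r (1 + n)) n :=
    fun n => H (1 + n)
  have h3 : ∀ n, b (1 + n) ≤ 3 := fun n => by rw [add_comm]; exact E.le_three H n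
  have h13 : ∀ n, b (3 + n) = 1 ∨ b (3 + n) = 3 := fun n => by
    have := E1.eq_one_or_three h3 H1 n
    rwa [show 3 + n = 1 + (n + 2) by omega]
  constructor
  · rw [show 8 + n = 3 + (5 + n) by omega]; exact h13 _
  · intro h
    have h' : b (3 + (n + 5)) = 3 := by rwa [show 3 + (n + 5) = 8 + n by omega]
    have := (E.shift 3).isShort_or_isLong h13 (fun n => H (3 + n)) n h'
    rw [show 8 + n = 3 + (n + 5) by omega]
    exact this

/-- A long gap starting at `n`, then `m` short gaps, then another long gap. -/
def IsBlock (b : ℕ → ℕ) (n m : ℕ) : Prop :=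
  IsLong b n ∧ (∀ j < m, IsShort b (n + 5 + 3 * j)) ∧ IsLong b (n + 5 + 3 * m)

theorem Expansion.l_mem_Icc (E : Expansion b l r) (n : ℕ) : l n ∈ Set.Icc (0 : ℝ) 1 :=
  ⟨E.l_nonneg n, E.l_le_one n⟩

theorem Expansion.r_mem_Icc (E : Expansion b l r) (n : ℕ) : r n ∈ Set.Icc (0 : ℝ) 1 :=
  ⟨(E.r_pos n).le, (E.r_lt_one n).le⟩

theorem IsBlock.l_eq (E : Expansion b l r) {n m : ℕ} (h : IsBlock b n m) :
    l (n + 5 + 3 * m) = shortGap^[m] (longGap (l n)) := by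
  rw [E.l_iterate h.2.1, E.l_longGap h.1]

theorem IsBlock.r_eq (E : Expansion b l r) {n m : ℕ} (h : IsBlock b n m) :
    r (n + 5) = shortGap^[m] (longGap (r (n + 5 + 3 * m + 5))) := by
  rw [E.r_iterate h.2.1, E.r_longGap h.2.2]

/-- Consecutive blocks have the same odd length. -/
theorem Expansion.eq_of_isBlock (E : Expansion b l r) (H : ∀ n, BelowAt b l r n) {n m m' : ℕ}
    (h : IsBlock b n m) (h' : IsBlock b (n + 5 + 3 * m) m') : Odd m ∧ m = m' := by
  have e1 := h.l_eq E
  have e2 := h'.r_eq E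
  have e3 := E.l_longGap h.2.2
  have e4 := E.r_longGap h.2.2
  have g1 := ((H _).values_of_three h.2.2.1).1
  have g2 := ((H _).values_of_three h.2.2.2.2.2.2.2).1
  rw [e4, e1, e2, lamInf_eq] at g1
  rw [e3, e1, e2, lamInf_eq] at g2
  refine eq_of_longGap_add_lt (longGap_mem (E.l_mem_Icc n)) 
    (longGap_mem (E.r_mem_Icc (n + 5 + 3 * m + 5 + 3 * m' + 5))) ?_ ?_
  · rw [longGap_eta]; linarith
  · rw [longGap_eta]; linarith

/-- The three shapes of an expansion all of whose values are below `λ_∞`. -/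
theorem Expansion.classification (E : Expansion b l r) (H : ∀ n, BelowAt b l r n) :
    (∃ N, ∀ n, b (N + n) = 1) ∨ (∃ N, ∀ j, IsShort b (N + 3 * j)) ∨
      ∃ N m, Odd m ∧ ∀ k, IsBlock b (N + k * (5 + 3 * m)) m := by
  have G := E.eventually_gaps H
  by_cases h3 : ∃ N, 8 ≤ N ∧ b N = 3
  swap
  · push Not at h3
    exact Or.inl ⟨8, fun n => (G (8 + n) (by omega)).1.resolve_right (h3 _ (by omega))⟩
  right
  by_cases hshort : ∃ N, ∀ j, IsShort b (N + 3 * j)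
  · exact Or.inl hshort
  right
  -- from every `3` a run of short gaps leads to a long gap
  have run : ∀ n, 8 ≤ n → b n = 3 →
      ∃ m, (∀ j < m, IsShort b (n + 3 * j)) ∧ IsLong b (n + 3 * m) := by
    intro n hn hb
    have hex : ∃ j, ¬IsShort b (n + 3 * j) := by
      by_contra! hcon
      exact hshort ⟨n, hcon⟩
    classical
    refine ⟨Nat.find hex, fun j hj => not_not.1 (Nat.find_min hex hj), ?_⟩
    have hspec := Nat.find_spec hex
    have hb' : b (n + 3 * Nat.find hex) = 3 := by
      rcases Nat.eq_zero_or_pos (Nat.find hex) with h0 | h0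
      · rw [h0]; exact hb
      · have := (not_not.1 (Nat.find_min hex (Nat.sub_lt h0 one_pos))).2.2.2
        rwa [show n + 3 * (Nat.find hex - 1) + 3 = n + 3 * Nat.find hex by omega] at this
    exact ((G _ (by omega)).2 hb').resolve_left hspec
  have block : ∀ n, 8 ≤ n → IsLong b n → ∃ m, IsBlock b n m := fun n hn h =>
    (run (n + 5) (by omega) h.2.2.2.2.2).imp fun m hm => ⟨h, hm⟩
  obtain ⟨N₀, hN₀, hb⟩ := h3
  obtain ⟨m₀, -, hm₀⟩ := run N₀ hN₀ hb
  obtain ⟨m, hm⟩ := block _ (by omega) hm₀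
  refine ⟨N₀ + 3 * m₀, m, ?_, ?_⟩
  · obtain ⟨m', hm'⟩ := block _ (by omega) hm.2.2
    exact (E.eq_of_isBlock H hm hm').1
  · intro k
    induction k with
    | zero => simpa using hm
    | succ k ih =>
      obtain ⟨m', hm'⟩ := block _ (by omega) ih.2.2
      obtain rfl := (E.eq_of_isBlock H ih hm').2
      convert hm' using 1
      ring

end Structure

/-! ### Values of infinite continued fractions -/

/-- Two steps of a continued fraction contract by the factor `4`. -/
theorem abs_two_steps_le {a b u v : ℝ} (ha : 1 ≤ a) (hb : 1 ≤ b) (hu : 0 ≤ u) (hv : 0 ≤ v) :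
    |1 / (a + 1 / (b + u)) - 1 / (a + 1 / (b + v))| ≤ |u - v| / 4 := by
  have hu' : 0 < b + u := by linarith
  have hv' : 0 < b + v := by linarith
  have h1 : 2 ≤ a * (b + u) + 1 := by nlinarith
  have h2 : 2 ≤ a * (b + v) + 1 := by nlinarith
  have e : 1 / (a + 1 / (b + u)) - 1 / (a + 1 / (b + v)) =
      (u - v) / ((a * (b + u) + 1) * (a * (b + v) + 1)) := by
    have : a + 1 / (b + u) = (a * (b + u) + 1) / (b + u) := by field_simp
    rw [this]
    have : a + 1 / (b + v) = (a * (b + v) + 1) / (b + v) := by field_simp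
    rw [this, one_div_div, one_div_div, div_sub_div _ _ (by linarith) (by linarith)]
    congr 1
    ring
  rw [e, abs_div]
  refine div_le_div_of_nonneg_left (abs_nonneg _) (by norm_num) ?_
  exact le_trans (by nlinarith) (le_abs_self _)

theorem cfConvergent_mem {a : ℕ → ℕ} (ha : ∀ i, 1 ≤ a (i + 1)) (n : ℕ) :
    cfConvergent a n ∈ Set.Icc (a 0 : ℝ) (a 0 + 1) := by
  induction n generalizing a with
  | zero => simp [cfConvergent]
  | succ n ih =>
    have h := (ih (a := fun i => a (i + 1)) fun i => ha (i + 1)).1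
    have h1 : (1 : ℝ) ≤ a (0 + 1) := by exact_mod_cast ha 0
    have h2 : 1 ≤ cfConvergent (fun i => a (i + 1)) n := h1.trans h
    rw [cfConvergent]
    refine ⟨?_, ?_⟩
    · have : 0 ≤ 1 / cfConvergent (fun i => a (i + 1)) n := by positivity
      linarith
    · have : 1 / cfConvergent (fun i => a (i + 1)) n ≤ 1 := by
        rw [div_le_one (by linarith)]; exact h2
      linarith

theorem dist_cfConvergent_succ {a : ℕ → ℕ} (ha : ∀ i, 1 ≤ a (i + 1)) (n : ℕ) :
    dist (cfConvergent a n) (cfConvergent a (n + 1)) ≤ 2 * (1 / 2) ^ n := by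
  have base : ∀ n, dist (cfConvergent a n) (cfConvergent a (n + 1)) ≤ 1 := fun n => by
    have h1 := cfConvergent_mem ha n
    have h2 := cfConvergent_mem ha (n + 1)
    exact (Real.dist_le_of_mem_Icc h1 h2).trans (by linarith)
  induction n using Nat.strong_induction_on generalizing a with
  | _ n ih =>
    match n with
    | 0 => exact (base 0).trans (by norm_num)
    | 1 => exact (base 1).trans (by norm_num)
    | n + 2 =>
      have ha2 : ∀ i, 1 ≤ a (i + 1 + 1 + 1) := fun i => ha _
      have h := ih n (by omega) (a := fun i => a (i + 1 + 1)) ha2 fun n => by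
        exact (Real.dist_le_of_mem_Icc (cfConvergent_mem ha2 n)
          (cfConvergent_mem ha2 (n + 1))).trans (by linarith)
      have h1 : (1 : ℝ) ≤ a (0 + 1) := by exact_mod_cast ha 0
      have h2 : (1 : ℝ) ≤ a (0 + 1 + 1) := by exact_mod_cast ha 1
      have m1 := (cfConvergent_mem (a := fun i => a (i + 1 + 1)) ha2 n).1
      have m2 := (cfConvergent_mem (a := fun i => a (i + 1 + 1)) ha2 (n + 1)).1
      simp only [cfConvergent, Real.dist_eq, add_sub_add_left_eq_sub] at h m1 m2 ⊢
      have key := abs_two_steps_le (u := cfConvergent (fun i => a (i + 1 + 1)) n - 1)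
        (v := a (0 + 1 + 1) + 1 / cfConvergent (fun i => a (i + 1 + 1 + 1)) n - 1) h1 le_rfl
        (by linarith) (by linarith)
      simp only [add_sub_cancel] at key
      refine key.trans ?_
      rw [sub_sub_sub_cancel_right, pow_add]
      linarith

theorem tendsto_cfConvergent {a : ℕ → ℕ} (ha : ∀ i, 1 ≤ a (i + 1)) :
    Tendsto (cfConvergent a) atTop (𝓝 (cfValue a)) :=
  (cauchySeq_of_le_geometric (1 / 2) 2 (by norm_num) (dist_cfConvergent_succ ha)).tendsto_limUnder

theorem le_cfValue {a : ℕ → ℕ} (ha : ∀ i, 1 ≤ a (i + 1)) : (a 0 : ℝ) ≤ cfValue a :=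
  ge_of_tendsto' (tendsto_cfConvergent ha) fun n => (cfConvergent_mem ha n).1

theorem cfValue_eq {a : ℕ → ℕ} (ha : ∀ i, 1 ≤ a (i + 1)) :
    cfValue a = a 0 + 1 / cfValue fun i => a (i + 1) := by
  have h1 : (1 : ℝ) ≤ a (0 + 1) := by exact_mod_cast ha 0
  have h2 := le_cfValue (a := fun i => a (i + 1)) fun i => ha (i + 1)
  have h3 := tendsto_cfConvergent (a := fun i => a (i + 1)) fun i => ha (i + 1)
  refine tendsto_nhds_unique ((tendsto_add_atTop_iff_nat 1).2 (tendsto_cfConvergent ha)) ?_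
  exact tendsto_const_nhds.add (tendsto_const_nhds.div h3 (by linarith))

theorem one_lt_cfValue {a : ℕ → ℕ} (ha : ∀ i, 1 ≤ a i) : 1 < cfValue a := by
  have h0 : (1 : ℝ) ≤ a 0 := by exact_mod_cast ha 0
  have h1 : (1 : ℝ) ≤ a (0 + 1) := by exact_mod_cast ha 1
  have h2 := le_cfValue (a := fun i => a (i + 1)) fun i => ha (i + 1 + 1)
  rw [cfValue_eq fun i => ha (i + 1)]
  have : 0 < 1 / cfValue fun i => a (i + 1) := one_div_pos.2 (by linarith)
  linarith

theorem floor_cfValue {a : ℕ → ℕ} (ha : ∀ i, 1 ≤ a (i + 1)) : ⌊cfValue a⌋ = a 0 := by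
  have h := one_lt_cfValue (a := fun i => a (i + 1)) ha
  have h1 : 0 < 1 / cfValue fun i => a (i + 1) := one_div_pos.2 (by linarith)
  have h2 : (1 / cfValue fun i => a (i + 1)) < 1 := by rwa [div_lt_one (by linarith)]
  rw [Int.floor_eq_iff, cfValue_eq ha]
  push_cast
  constructor <;> linarith

theorem fract_cfValue {a : ℕ → ℕ} (ha : ∀ i, 1 ≤ a (i + 1)) :
    Int.fract (cfValue a) = (cfValue fun i => a (i + 1))⁻¹ := by
  rw [Int.fract, floor_cfValue ha]
  nth_rw 1 [cfValue_eq ha]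
  push_cast
  ring

theorem completeQuotient_cfValue {a : ℕ → ℕ} (ha : ∀ i, 1 ≤ a (i + 1)) (n : ℕ) :
    completeQuotient (cfValue a) n = cfValue fun i => a (n + i) := by
  induction n with
  | zero => simp [completeQuotient]
  | succ n ih =>
    rw [completeQuotient, ih, fract_cfValue fun i => ha (n + i), inv_inv]
    congr 1
    funext i
    congr 1
    ring

theorem irrational_cfValue {a : ℕ → ℕ} (ha : ∀ i, 1 ≤ a (i + 1)) : Irrational (cfValue a) := by
  refine irrational_of_fract_completeQuotient fun n => ?_
  rw [completeQuotient_cfValue ha, fract_cfValue fun i => ha (n + i)]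
  have := one_lt_cfValue (a := fun i => a (n + (i + 1))) fun i => ha (n + i)
  exact (inv_pos.2 (by linarith)).ne'

theorem digit_cfValue {a : ℕ → ℕ} (ha : ∀ i, 1 ≤ a (i + 1)) (n : ℕ) :
    digit (cfValue a) n = a (n + 1) := by
  rw [digit, completeQuotient_cfValue ha, ← Int.floor_toNat, floor_cfValue fun i => ?_]
  · simp
  · exact ha (n + 1 + i)

/-! ### Periodic continued fractions -/

theorem periodicFrom_pos {b : ℕ} {w : List ℕ} (hne : w ≠ []) (hw : ∀ x ∈ w, 1 ≤ x) (i : ℕ) :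
    1 ≤ periodicFrom b w (i + 1) := by
  have hi : i % w.length < w.length := Nat.mod_lt _ (List.length_pos_iff.2 hne)
  rw [periodicFrom, List.getD_eq_getElem _ _ hi]
  exact hw _ (List.getElem_mem hi)

theorem periodicFrom_cons_succ (b c : ℕ) (w : List ℕ) (i : ℕ) :
    periodicFrom b (c :: w) (i + 1) = periodicFrom c (w ++ [c]) i := by
  rcases i with _ | j
  · simp [periodicFrom]
  simp only [periodicFrom, List.length_cons, List.length_append, List.length_nil, zero_add]
  have hdiv := Nat.mod_add_div j (w.length + 1)
  have hlt := Nat.mod_lt j (Nat.succ_pos w.length)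
  set q := j / (w.length + 1)
  rcases (Nat.lt_succ_iff.1 hlt).lt_or_eq with h | h
  · have e : (j + 1) % (w.length + 1) = j % (w.length + 1) + 1 := by
      conv_lhs => rw [← hdiv, add_right_comm, Nat.add_mul_mod_self_left]
      exact Nat.mod_eq_of_lt (by simpa using h)
    rw [e, List.getD_cons_succ, List.getD_append _ _ _ _ h]
  · have h' : j % (w.length + 1) = w.length := h
    have e : (j + 1) % (w.length + 1) = 0 := by
      conv_lhs => rw [← hdiv, add_right_comm, Nat.add_mul_mod_self_left, h']
      exact Nat.mod_self _
    rw [e, h', List.getD_append_right _ _ _ _ le_rfl]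
    simp

/-- The value of the purely periodic continued fraction `[0; w, w, …]`. -/
def periodicValue (w : List ℕ) : ℝ := cfValue (periodicFrom 0 w)

theorem cfValue_periodicFrom (b : ℕ) {w : List ℕ} (hne : w ≠ []) (hw : ∀ x ∈ w, 1 ≤ x) :
    cfValue (periodicFrom b w) = b + periodicValue w := by
  rw [periodicValue, cfValue_eq (periodicFrom_pos hne hw),
    cfValue_eq (periodicFrom_pos (b := 0) hne hw)]
  simp [periodicFrom]

/-- Rotating the period moves its first letter out of the periodic part. -/
theorem periodicValue_cons {c : ℕ} {w : List ℕ} (hw : ∀ x ∈ c :: w, 1 ≤ x) :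
    periodicValue (c :: w) = 1 / (c + periodicValue (w ++ [c])) := by
  rw [periodicValue, cfValue_eq (periodicFrom_pos (by simp) hw)]
  simp only [periodicFrom_cons_succ]
  rw [cfValue_periodicFrom c (by simp) (fun x hx => hw x (by simpa [or_comm] using hx))]
  simp [periodicFrom]

theorem periodicValue_mem {w : List ℕ} (hne : w ≠ []) (hw : ∀ x ∈ w, 1 ≤ x) :
    periodicValue w ∈ Set.Icc (0 : ℝ) 1 := by
  have h := one_lt_cfValue (a := fun i => periodicFrom 0 w (i + 1)) (periodicFrom_pos hne hw)
  rw [periodicValue, cfValue_eq (periodicFrom_pos hne hw)]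
  simp only [periodicFrom, Nat.cast_zero, zero_add] at h ⊢
  exact ⟨by positivity, by rw [div_le_one (by linarith)]; exact h.le⟩

theorem periodicValue_short {w : List ℕ} (hw : ∀ x ∈ w, 1 ≤ x) :
    periodicValue ([1, 1, 3] ++ w) = shortGap (periodicValue (w ++ [1, 1, 3])) := by
  have hpos := (periodicValue_mem (w := w ++ [1, 1, 3]) (by simp)
    (by simpa [or_imp, forall_and] using hw)).1
  have h : ∀ u v : List ℕ, (∀ x ∈ u, 1 ≤ x) → (∀ x ∈ v, 1 ≤ x) → ∀ x ∈ u ++ v, 1 ≤ x :=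
    fun u v hu hv x hx => (List.mem_append.1 hx).elim (hu x) (hv x)
  have e3 := periodicValue_cons (c := 3) (w := w ++ [1, 1]) (h [3] _ (by simp) (h w _ hw (by simp)))
  have e2 := periodicValue_cons (c := 1) (w := 3 :: (w ++ [1]))
    (h [1, 3] _ (by simp) (h w _ hw (by simp)))
  have e1 := periodicValue_cons (c := 1) (w := 1 :: 3 :: w) (h [1, 1, 3] _ (by simp) hw)
  simp only [List.append_assoc, List.cons_append, List.nil_append] at *
  rw [e1, e2, e3, shortGap]
  push_cast
  field_simp
  ring

theorem periodicValue_long {w : List ℕ} (hw : ∀ x ∈ w, 1 ≤ x) :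
    periodicValue ([1, 1, 1, 1, 3] ++ w) =
      longGap (periodicValue (w ++ [1, 1, 1, 1, 3])) := by
  have hpos := (periodicValue_mem (w := w ++ [1, 1, 1, 1, 3]) (by simp)
    (by simpa [or_imp, forall_and] using hw)).1
  have h : ∀ u v : List ℕ, (∀ x ∈ u, 1 ≤ x) → (∀ x ∈ v, 1 ≤ x) → ∀ x ∈ u ++ v, 1 ≤ x :=
    fun u v hu hv x hx => (List.mem_append.1 hx).elim (hu x) (hv x)
  have e5 := periodicValue_cons (c := 3) (w := w ++ [1, 1, 1, 1])
    (h [3] _ (by simp) (h w _ hw (by simp)))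
  have e4 := periodicValue_cons (c := 1) (w := 3 :: (w ++ [1, 1, 1]))
    (h [1, 3] _ (by simp) (h w _ hw (by simp)))
  have e3 := periodicValue_cons (c := 1) (w := 1 :: 3 :: (w ++ [1, 1]))
    (h [1, 1, 3] _ (by simp) (h w _ hw (by simp)))
  have e2 := periodicValue_cons (c := 1) (w := 1 :: 1 :: 3 :: (w ++ [1]))
    (h [1, 1, 1, 3] _ (by simp) (h w _ hw (by simp)))
  have e1 := periodicValue_cons (c := 1) (w := 1 :: 1 :: 1 :: 3 :: w)
    (h [1, 1, 1, 1, 3] _ (by simp) hw)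
  simp only [List.append_assoc, List.cons_append, List.nil_append] at *
  rw [e1, e2, e3, e4, e5, longGap]
  push_cast
  field_simp
  ring

theorem rep_succ (m : ℕ) (w : List ℕ) : rep (m + 1) w = w ++ rep m w := by
  simp [rep, List.replicate_succ]

theorem one_le_of_mem_rep {m : ℕ} {w : List ℕ} (hw : ∀ x ∈ w, 1 ≤ x) : ∀ x ∈ rep m w, 1 ≤ x := by
  intro x hx
  simp only [rep, List.mem_flatten, List.mem_replicate] at hx
  obtain ⟨_, ⟨-, rfl⟩, h⟩ := hx
  exact hw x h

theorem periodicValue_rep (m : ℕ) {w : List ℕ} (hw : ∀ x ∈ w, 1 ≤ x) :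
    periodicValue (rep m [1, 1, 3] ++ w) =
      shortGap^[m] (periodicValue (w ++ rep m [1, 1, 3])) := by
  induction m generalizing w with
  | zero => simp [rep]
  | succ m ih =>
    have h113 : ∀ x ∈ [1, 1, 3], 1 ≤ x := by simp
    rw [Function.iterate_succ_apply', rep_succ, List.append_assoc,
      periodicValue_short (fun x hx => ?_), List.append_assoc, ih (fun x hx => ?_),
      List.append_assoc]
    · rcases List.mem_append.1 hx with h | h
      exacts [hw x h, h113 x h]
    · rcases List.mem_append.1 hx with h | h
      exacts [one_le_of_mem_rep h113 x h, hw x h]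

theorem rep_rotate (m : ℕ) : rep m [3, 1, 1] ++ [3] = 3 :: rep m [1, 1, 3] := by
  induction m with
  | zero => simp [rep]
  | succ m ih => rw [rep_succ, List.append_assoc, ih, rep_succ]; rfl

theorem xi_eq (n : ℕ) :
    xi n = periodicValue ([1, 1, 1, 1, 3] ++ rep (2 * n - 5) [1, 1, 3]) := rfl

theorem xi_mem (n : ℕ) : xi n ∈ Set.Icc (0 : ℝ) 1 := by
  refine periodicValue_mem (by simp) fun x hx => ?_
  rcases List.mem_append.1 hx with h | h
  · simp at h; omega
  · exact one_le_of_mem_rep (by simp) x h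

/-- The defining equation of `ξ_n`. -/
theorem xi_fixed (n : ℕ) : xi n = longGap (shortGap^[2 * n - 5] (xi n)) := by
  conv_lhs => rw [xi_eq, periodicValue_long (one_le_of_mem_rep (by simp)),
    periodicValue_rep _ (by simp)]
  rw [xi_eq]

theorem lam_eq {n : ℕ} (hn : 3 ≤ n) :
    lam n = (3 + shortGap^[2 * n - 5] (xi n) + xi n) / 4 := by
  have h113 : ∀ x ∈ [1, 1, 3], 1 ≤ x := by simp
  have h311 : ∀ x ∈ [3, 1, 1], 1 ≤ x := by simp
  rw [lam, if_neg (by omega), if_neg (by omega), cfValue_periodicFrom 3 (by simp) (fun x hx => ?_),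
    periodicValue_rep _ (by simp), List.append_assoc, rep_rotate]
  · rfl
  · rcases List.mem_append.1 hx with h | h
    · exact one_le_of_mem_rep h113 x h
    · simp at h; omega

/-! ### The values of `λ^{[2]}` -/

theorem lambda2_eq_of_frequently {α L : ℝ} (hα : Irrational α)
    (upper : ∀ c > L, lambda2 α ≤ (c : EReal))
    (lower : ∀ c < L, ∃ᶠ n in atTop,
      c ≤ (digit α n + leftTail (digit α) n + rightTail α n) / 4) :
    lambda2 α = (L : EReal) := by
  refine le_antisymm ?_ ?_
  · refine le_of_forall_gt fun x hx => ?_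
    obtain ⟨c, h1, h2⟩ := EReal.lt_iff_exists_real_btwn.1 hx
    exact (upper c (by exact_mod_cast h1)).trans_lt h2
  · by_contra! hlt
    obtain ⟨c, h1, h2⟩ := EReal.lt_iff_exists_real_btwn.1 hlt
    refine lower c (by exact_mod_cast h2) ?_
    filter_upwards [eventually_lt_of_lambda2_lt hα h1] with n hn
    exact not_le.2 hn.1

section Candidates

variable {b : ℕ → ℕ} {l r : ℕ → ℝ}

/-- All the values at the `n`-th partial quotient are at most `c`. -/
def AtMostAt (b : ℕ → ℕ) (l r : ℕ → ℝ) (c : ℝ) (n : ℕ) : Prop :=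
  (b n + l n + r n) / 4 ≤ c ∧ ∀ d : ℕ, 1 ≤ d → d < b n → 1 / (d + l n) + 1 / (b n - d + r n) ≤ c

theorem Expansion.atMostAt_of_eq_one (E : Expansion b l r) {c : ℝ} (hc : 1 ≤ c) {n : ℕ}
    (h : b n = 1) : AtMostAt b l r c n := by
  refine ⟨?_, fun d h1 h2 => by omega⟩
  have := E.l_le_one n
  have := E.r_lt_one n
  rw [h]
  push_cast
  linarith

theorem atMostAt_of_eq_three {c : ℝ} {n : ℕ} (h : b n = 3) (h1 : (3 + l n + r n) / 4 ≤ c)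
    (h2 : 1 / (1 + l n) + 1 / (2 + r n) ≤ c) (h3 : 1 / (1 + r n) + 1 / (2 + l n) ≤ c) :
    AtMostAt b l r c n := by
  refine ⟨by rw [h]; exact_mod_cast h1, fun d hd1 hd2 => ?_⟩
  rw [h] at hd2 ⊢
  rcases (show d = 1 ∨ d = 2 by omega) with rfl | rfl
  · norm_num at h2 ⊢; exact h2
  · norm_num at h3 ⊢; rw [add_comm]; exact h3

/-- Next to a gap of two or four `1`s on either side, only the multiples `2 q` matter. -/
theorem atMostAt_of_le {c : ℝ} {n : ℕ} (hc : 1.035 ≤ c) (h : b n = 3) (hl : 5 / 9 ≤ l n)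
    (hr : 5 / 9 ≤ r n) (h1 : (3 + l n + r n) / 4 ≤ c) : AtMostAt b l r c n := by
  have e : ∀ x : ℝ, 5 / 9 ≤ x → 1 / (1 + x) ≤ 9 / 14 ∧ 1 / (2 + x) ≤ 9 / 23 := fun x hx =>
    ⟨by rw [div_le_div_iff₀ (by linarith) (by norm_num)]; linarith,
      by rw [div_le_div_iff₀ (by linarith) (by norm_num)]; linarith⟩
  obtain ⟨l1, l2⟩ := e _ hl
  obtain ⟨r1, r2⟩ := e _ hr
  exact atMostAt_of_eq_three h h1 (by linarith) (by linarith)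

end Candidates

theorem shortGap_bounds {z : ℝ} (hz : z ∈ Set.Icc (0 : ℝ) 1) :
    shortGap z ∈ Set.Icc (5 / 9 : ℝ) (4 / 7) := by
  obtain ⟨h0, h1⟩ := hz
  rw [shortGap]
  constructor
  · rw [div_le_div_iff₀ (by norm_num) (by positivity)]; linarith
  · rw [div_le_div_iff₀ (by positivity) (by norm_num)]; linarith

theorem abs_shortGap_sub_le {x y : ℝ} (hx : 0 ≤ x) (hy : 0 ≤ y) :
    |shortGap x - shortGap y| ≤ |x - y| := by
  rw [shortGap_sub hx hy, abs_div, abs_neg]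
  refine div_le_self (abs_nonneg _) ?_
  exact le_trans (by nlinarith) (le_abs_self _)

theorem abs_iterate_shortGap_sub_le {x y : ℝ} (hx : x ∈ Set.Icc (0 : ℝ) 1)
    (hy : y ∈ Set.Icc (0 : ℝ) 1) (m : ℕ) : |shortGap^[m] x - shortGap^[m] y| ≤ |x - y| := by
  induction m with
  | zero => rfl
  | succ m ih =>
    rw [Function.iterate_succ_apply', Function.iterate_succ_apply']
    exact (abs_shortGap_sub_le (iterate_shortGap_mem hx m).1 (iterate_shortGap_mem hy m).1).trans ih

theorem abs_longGap_sub_le {x y : ℝ} (hx : 0 ≤ x) (hy : 0 ≤ y) :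
    |longGap x - longGap y| ≤ |x - y| / 2 := by
  rw [longGap_sub hx hy, abs_div, abs_neg]
  refine div_le_div_of_nonneg_left (abs_nonneg _) (by norm_num) ?_
  exact le_trans (by nlinarith) (le_abs_self _)

/-- Iterates of `shortGap` converge to `eta`, uniformly on the unit interval. -/
theorem abs_iterate_shortGap_sub_eta_le {z : ℝ} (hz : z ∈ Set.Icc (0 : ℝ) 1) (m : ℕ) :
    |shortGap^[m] z - eta| ≤ 2 * (1 / 2) ^ m := by
  have he := eta_gt
  have he' := eta_lt
  have hk := mult_pos
  have hk' := mult_lt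
  obtain ⟨h0, h1⟩ := iterate_shortGap_mem hz m
  rw [sub_eta_eq h0, linCoord_iterate hz, abs_mul, abs_mul, abs_pow, abs_neg, abs_of_pos hk]
  have e1 : |linCoord z| ≤ 1 / 3 := by
    rw [linCoord, abs_div, abs_of_pos (show 0 < z + eta + 3 by linarith [hz.1]),
      div_le_div_iff₀ (by linarith [hz.1]) (by norm_num)]
    have : |z - eta| ≤ 1 := by rw [abs_le]; constructor <;> linarith [hz.1, hz.2]
    linarith [hz.1]
  have e2 : |shortGap^[m] z + eta + 3| ≤ 6 := by rw [abs_le]; constructor <;> linarith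
  have e3 : mult ^ m ≤ (1 / 2) ^ m := pow_le_pow_left₀ hk.le (by linarith) m
  calc mult ^ m * |linCoord z| * |shortGap^[m] z + eta + 3|
      ≤ (1 / 2) ^ m * (1 / 3) * 6 := by gcongr
    _ = 2 * (1 / 2) ^ m := by ring

/-! ### Chains of blocks -/

/-- Consecutive blocks, the `k`-th one starting at `p k` and having `m k` short gaps. -/
structure IsChain (b p m : ℕ → ℕ) : Prop where
  block : ∀ k, IsBlock b (p k) (m k)
  succ : ∀ k, p (k + 1) = p k + 5 + 3 * m k
  pos : ∀ k, 1 ≤ m k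

section Chain

variable {b p m : ℕ → ℕ} {l r : ℕ → ℝ}

theorem IsChain.le (C : IsChain b p m) (k : ℕ) : k ≤ p k := by
  induction k with
  | zero => exact Nat.zero_le _
  | succ k ih => have := C.succ k; omega

theorem IsChain.exists_mem (C : IsChain b p m) (K : ℕ) {n : ℕ} (hn : p K ≤ n) :
    ∃ k, K ≤ k ∧ p k ≤ n ∧ n < p (k + 1) := by
  induction n, hn using Nat.le_induction with
  | base => exact ⟨K, le_rfl, le_rfl, by have := C.succ K; omega⟩
  | succ n hn ih =>
    obtain ⟨k, h1, h2, h3⟩ := ih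
    rcases (show n + 1 ≤ p (k + 1) by omega).lt_or_eq with h | h
    · exact ⟨k, h1, by omega, h⟩
    · exact ⟨k + 1, by omega, by omega, by have := C.succ (k + 1); omega⟩

theorem IsChain.l_succ (C : IsChain b p m) (E : Expansion b l r) (k : ℕ) :
    l (p (k + 1)) = shortGap^[m k] (l (p k + 5)) := by
  rw [C.succ, E.l_iterate (C.block k).2.1]

theorem IsChain.r_eq (C : IsChain b p m) (E : Expansion b l r) (k : ℕ) :
    r (p k + 5) = shortGap^[m k] (r (p (k + 1))) := by
  rw [C.succ, E.r_iterate (C.block k).2.1]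

/-- Away from the long gaps all values are small. -/
theorem IsChain.atMostAt (C : IsChain b p m) (E : Expansion b l r) {c : ℝ} (hc : 1.036 ≤ c) {K : ℕ}
    (hA : ∀ k ≥ K, l (p k) + r (p k) ≤ 4 * c - 3)
    (hB : ∀ k ≥ K, l (p k + 5) + r (p k + 5) ≤ 4 * c - 3) {n : ℕ} (hn : p (K + 1) ≤ n) :
    AtMostAt b l r c n := by
  obtain ⟨k, hk, h1, h2⟩ := C.exists_mem (K + 1) hn
  rw [C.succ] at h2
  obtain ⟨L, Sh, -⟩ := C.block k
  have hone : ∀ i, n = i → b i = 1 → AtMostAt b l r c n := fun i hi h => by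
    subst hi; exact E.atMostAt_of_eq_one (by linarith) h
  have shl : ∀ i, IsShort b i → l (i + 3) ∈ Set.Icc (5 / 9 : ℝ) (4 / 7) := fun i hi => by
    rw [E.l_shortGap hi.1 hi.2.1 hi.2.2.1]; exact shortGap_bounds (E.l_mem_Icc i)
  have shr : ∀ i, IsShort b i → r i ∈ Set.Icc (5 / 9 : ℝ) (4 / 7) := fun i hi => by
    rw [E.r_shortGap hi]; exact shortGap_bounds (E.r_mem_Icc _)
  by_cases h5 : n < p k + 5
  · obtain ⟨i, rfl⟩ := Nat.exists_eq_add_of_le h1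
    have hi : i < 5 := by omega
    interval_cases i
    · -- the partial quotient to the left of the long gap
      obtain ⟨k, rfl⟩ := Nat.exists_eq_add_of_le' (show 1 ≤ k by omega)
      have hs := (C.block k).2.1 (m k - 1) (by have := C.pos k; omega)
      have hl := (shl _ hs).1
      rw [show p k + 5 + 3 * (m k - 1) + 3 = p (k + 1) by
        have := C.pos k; have := C.succ k; omega] at hl
      have hr : r (p (k + 1)) ∈ Set.Icc (14 / 23 : ℝ) (11 / 18) := by
        rw [E.r_longGap L]; exact longGap_mem (E.r_mem_Icc _)
      refine atMostAt_of_le (by linarith) L.1 hl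
        (show 5 / 9 ≤ r (p (k + 1)) by linarith [hr.1]) ?_
      have : l (p (k + 1)) + r (p (k + 1)) ≤ 4 * c - 3 := hA (k + 1) (by omega)
      simp only [add_zero]
      linarith
    · exact hone _ rfl L.2.1
    · exact hone _ rfl L.2.2.1
    · exact hone _ rfl L.2.2.2.1
    · exact hone _ rfl L.2.2.2.2.1
  · obtain ⟨i, rfl⟩ := Nat.exists_eq_add_of_le (not_lt.1 h5)
    have hi := Nat.div_add_mod i 3
    have hi3 := Nat.mod_lt i (show 0 < 3 by norm_num)
    have hS := Sh (i / 3) (by omega)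
    rcases (show i % 3 = 0 ∨ i % 3 = 1 ∨ i % 3 = 2 by omega) with h | h | h
    · rcases Nat.eq_zero_or_pos (i / 3) with h0 | h0
      · -- the partial quotient to the right of the long gap
        obtain rfl : i = 0 := by omega
        have hr := (shr _ hS).1
        have hl : l (p k + 5) ∈ Set.Icc (14 / 23 : ℝ) (11 / 18) := by
          rw [E.l_longGap L]; exact longGap_mem (E.l_mem_Icc _)
        simp only [Nat.zero_div, mul_zero, add_zero] at hr ⊢
        refine atMostAt_of_le (by linarith) L.2.2.2.2.2 (by linarith [hl.1]) hr ?_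
        have := hB k (by omega)
        linarith
      · have hl := shl _ (Sh (i / 3 - 1) (by omega))
        have hr := shr _ hS
        rw [show p k + 5 + 3 * (i / 3 - 1) + 3 = p k + 5 + i by omega] at hl
        rw [show p k + 5 + 3 * (i / 3) = p k + 5 + i by omega] at hr hS
        refine atMostAt_of_le (by linarith) hS.1 hl.1 hr.1 ?_
        linarith [hl.2, hr.2]
    · exact hone _ (by omega) hS.2.1
    · exact hone _ (by omega) hS.2.2.1

end Chain

/-- The value of `λ^{[2]}` for a chain of blocks is decided at the long gaps. -/
theorem lambda2_of_isChain {α S : ℝ} (hα : Irrational α) {p m : ℕ → ℕ}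
    (C : IsChain (digit α) p m) (hS : 1.15 ≤ S)
    (hA : Tendsto (fun k => leftTail (digit α) (p k) + rightTail α (p k)) atTop (𝓝 S))
    (hB : Tendsto (fun k => leftTail (digit α) (p k + 5) + rightTail α (p k + 5)) atTop (𝓝 S)) :
    lambda2 α = (((3 + S) / 4 : ℝ) : EReal) := by
  have E := expansion hα
  refine lambda2_eq_of_frequently hα (fun c hc => ?_) fun c hc => ?_
  · refine lambda2_le_of_eventually hα (by linarith) ?_
    have hS' : S < 4 * c - 3 := by linarith
    obtain ⟨K, hK⟩ := eventually_atTop.1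
      ((hA.eventually_lt_const hS').and (hB.eventually_lt_const hS'))
    filter_upwards [eventually_ge_atTop (p (K + 1))] with n hn
    exact C.atMostAt E (by linarith) (fun k hk => (hK k hk).1.le) (fun k hk => (hK k hk).2.le) hn
  · rw [frequently_atTop]
    intro N
    have hS' : 4 * c - 3 < S := by linarith
    obtain ⟨K, hK⟩ := eventually_atTop.1 (hA.eventually_const_lt hS')
    refine ⟨p (max K N), (le_max_right K N).trans (C.le _), ?_⟩
    have := hK (max K N) (le_max_left _ _)
    rw [(C.block _).1.1]
    push_cast
    linarith

/-- In a chain of blocks of constant length, the tail to the right of the last `3` of a block is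
the periodic continued fraction. -/
theorem IsChain.r_eq_fixed {b p : ℕ → ℕ} {l r : ℕ → ℝ} {m : ℕ} (E : Expansion b l r)
    (C : IsChain b p fun _ => m) {x : ℝ} (hx : x ∈ Set.Icc (0 : ℝ) 1)
    (hfix : x = longGap (shortGap^[m] x)) (k : ℕ) : r (p k) = x := by
  have key : ∀ j k, |r (p k) - x| ≤ (1 / 2) ^ j := by
    intro j
    induction j with
    | zero =>
      intro k
      have := E.r_mem_Icc (p k)
      rw [pow_zero, abs_le]
      constructor <;> linarith [this.1, this.2, hx.1, hx.2]
    | succ j ih =>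
      intro k
      have h1 := abs_longGap_sub_le (iterate_shortGap_mem (E.r_mem_Icc (p (k + 1))) m).1
        (iterate_shortGap_mem hx m).1
      rw [← hfix, ← C.r_eq E, ← E.r_longGap (C.block k).1] at h1
      have h2 := abs_iterate_shortGap_sub_le (E.r_mem_Icc (p (k + 1))) hx m
      rw [← C.r_eq E] at h2
      have h3 := ih (k + 1)
      rw [pow_succ]
      linarith
  have hlim : Tendsto (fun j : ℕ => ((1 : ℝ) / 2) ^ j) atTop (𝓝 0) :=
    tendsto_pow_atTop_nhds_zero_of_lt_one (by norm_num) (by norm_num)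
  have := ge_of_tendsto' hlim fun j => key j k
  exact sub_eq_zero.1 (abs_nonpos_iff.1 this)

theorem IsChain.tendsto_l {b p : ℕ → ℕ} {l r : ℕ → ℝ} {m : ℕ} (E : Expansion b l r)
    (C : IsChain b p fun _ => m) {x : ℝ} (hx : x ∈ Set.Icc (0 : ℝ) 1)
    (hfix : x = longGap (shortGap^[m] x)) :
    Tendsto (fun k => l (p k + 5)) atTop (𝓝 x) ∧
      Tendsto (fun k => l (p k)) atTop (𝓝 (shortGap^[m] x)) := by
  have key : ∀ k, |l (p k + 5) - x| ≤ (1 / 2) ^ k := by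
    intro k
    induction k with
    | zero =>
      have := E.l_mem_Icc (p 0 + 5)
      rw [pow_zero, abs_le]
      constructor <;> linarith [this.1, this.2, hx.1, hx.2]
    | succ k ih =>
      have h1 := abs_longGap_sub_le (iterate_shortGap_mem (E.l_mem_Icc (p k + 5)) m).1
        (iterate_shortGap_mem hx m).1
      rw [← hfix, ← C.l_succ E, ← E.l_longGap (C.block (k + 1)).1] at h1
      have h2 := abs_iterate_shortGap_sub_le (E.l_mem_Icc (p k + 5)) hx m
      rw [← C.l_succ E] at h2
      rw [pow_succ]
      linarith
  have hlim : Tendsto (fun j : ℕ => ((1 : ℝ) / 2) ^ j) atTop (𝓝 0) :=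
    tendsto_pow_atTop_nhds_zero_of_lt_one (by norm_num) (by norm_num)
  refine ⟨tendsto_iff_dist_tendsto_zero.2 (squeeze_zero (fun _ => dist_nonneg) key hlim), ?_⟩
  refine (tendsto_add_atTop_iff_nat 1).1 (tendsto_iff_dist_tendsto_zero.2
    (squeeze_zero (fun _ => dist_nonneg) (fun k => ?_) hlim))
  rw [C.l_succ E]
  exact (abs_iterate_shortGap_sub_le (E.l_mem_Icc (p k + 5)) hx m).trans (key k)

theorem xi_ge (n : ℕ) : 14 / 23 ≤ xi n := by
  rw [xi_fixed]
  exact (longGap_mem (iterate_shortGap_mem (xi_mem n) _)).1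

theorem xi_le (n : ℕ) : xi n ≤ 11 / 18 := by
  rw [xi_fixed]
  exact (longGap_mem (iterate_shortGap_mem (xi_mem n) _)).2

theorem iterate_shortGap_ge {z : ℝ} (hz : z ∈ Set.Icc (0 : ℝ) 1) {m : ℕ} (hm : 1 ≤ m) :
    5 / 9 ≤ shortGap^[m] z := by
  obtain ⟨m, rfl⟩ := Nat.exists_eq_add_of_le' hm
  rw [Function.iterate_succ_apply']
  exact (shortGap_bounds (iterate_shortGap_mem hz m)).1

theorem lambda2_of_isChain_const {α : ℝ} (hα : Irrational α) {n : ℕ} (hn : 3 ≤ n) {p : ℕ → ℕ}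
    (C : IsChain (digit α) p fun _ => 2 * n - 5) : lambda2 α = (lam n : EReal) := by
  have E := expansion hα
  obtain ⟨t1, t2⟩ := C.tendsto_l E (xi_mem n) (xi_fixed n)
  have hr := C.r_eq_fixed E (xi_mem n) (xi_fixed n)
  have h1 := xi_ge n
  have h2 := iterate_shortGap_ge (xi_mem n) (show 1 ≤ 2 * n - 5 by omega)
  rw [lam_eq hn, add_assoc]
  refine lambda2_of_isChain hα C (by norm_num at *; linarith) ?_ ?_
  · simp only [hr]
    exact t2.add_const _
  · simp only [C.r_eq E, hr]
    rw [add_comm (shortGap^[_] _)]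
    exact t1.add_const _

theorem lambda2_of_isChain_tendsto {α : ℝ} (hα : Irrational α) {p m : ℕ → ℕ}
    (C : IsChain (digit α) p m) (hm : Tendsto m atTop atTop) : lambda2 α = (lamInf : EReal) := by
  have E := expansion hα
  have he := eta_gt
  have hlim : Tendsto (fun k => (2 : ℝ) * (1 / 2) ^ m k) atTop (𝓝 0) := by
    have := (tendsto_pow_atTop_nhds_zero_of_lt_one (r := (1 / 2 : ℝ)) (by norm_num)
      (by norm_num)).comp hm
    simpa using this.const_mul 2
  have hcont : ContinuousAt longGap eta := by
    unfold longGap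
    exact ContinuousAt.div (by fun_prop) (by fun_prop) (by linarith)
  have t1 : Tendsto (fun k => leftTail (digit α) (p k)) atTop (𝓝 eta) := by
    refine (tendsto_add_atTop_iff_nat 1).1 (tendsto_iff_dist_tendsto_zero.2
      (squeeze_zero (fun _ => dist_nonneg) (fun k => ?_) hlim))
    rw [C.l_succ E]
    exact abs_iterate_shortGap_sub_eta_le (E.l_mem_Icc _) _
  have t2 : Tendsto (fun k => rightTail α (p k + 5)) atTop (𝓝 eta) := by
    refine tendsto_iff_dist_tendsto_zero.2
      (squeeze_zero (fun _ => dist_nonneg) (fun k => ?_) hlim)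
    rw [C.r_eq E]
    exact abs_iterate_shortGap_sub_eta_le (E.r_mem_Icc _) _
  have t3 : Tendsto (fun k => leftTail (digit α) (p k + 5)) atTop (𝓝 (longGap eta)) := by
    simp only [fun k => E.l_longGap (C.block k).1]
    exact hcont.tendsto.comp t1
  have t4 : Tendsto (fun k => rightTail α (p k)) atTop (𝓝 (longGap eta)) := by
    simp only [fun k => E.r_longGap (C.block k).1]
    exact hcont.tendsto.comp t2
  rw [show lamInf = (3 + (eta + longGap eta)) / 4 by rw [lamInf_eq, longGap_eta]; ring]
  refine lambda2_of_isChain hα C (by rw [longGap_eta]; norm_num at *; linarith) (t1.add t4) ?_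
  rw [add_comm eta]
  exact t3.add t2

/-! ### Numbers with prescribed blocks -/

/-- A state machine that writes the blocks of lengths `m 0, m 1, …`. In a state `(i, c, k)` there
are `i` letters `1` to write before the next `3`, then `c` short gaps before the next long gap,
and `k` long gaps have been started. -/
def blockState (m : ℕ → ℕ) : ℕ → ℕ × ℕ × ℕ
  | 0 => (0, 0, 0)
  | n + 1 =>
    match blockState m n with
    | (i + 1, c, k) => (i, c, k)
    | (0, c + 1, k) => (2, c, k)
    | (0, 0, k) => (4, m k, k + 1)

/-- The letters written by `blockState`. -/
def blockDigit (m : ℕ → ℕ) (n : ℕ) : ℕ := if (blockState m n).1 = 0 then 3 else 1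

/-- The position where the `k`-th block starts. -/
def blockPos (m : ℕ → ℕ) : ℕ → ℕ
  | 0 => 0
  | k + 1 => blockPos m k + 5 + 3 * m k

theorem blockState_long {m : ℕ → ℕ} {n k : ℕ} (h : blockState m n = (0, 0, k)) :
    IsLong (blockDigit m) n ∧ blockState m (n + 5) = (0, m k, k + 1) := by
  simp [IsLong, blockDigit, blockState, h]

theorem blockState_short {m : ℕ → ℕ} {n c k : ℕ} (h : blockState m n = (0, c + 1, k)) :
    IsShort (blockDigit m) n ∧ blockState m (n + 3) = (0, c, k) := by
  simp [IsShort, blockDigit, blockState, h]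

theorem blockState_iterate {m : ℕ → ℕ} {n c k j : ℕ} (h : blockState m n = (0, c + j, k)) :
    blockState m (n + 3 * j) = (0, c, k) := by
  induction j generalizing c with
  | zero => exact h
  | succ j ih => exact (blockState_short (ih (c := c + 1) (by rw [h]; simp; omega))).2

theorem isChain_blockDigit {m : ℕ → ℕ} (hm : ∀ k, 1 ≤ m k) :
    IsChain (blockDigit m) (blockPos m) m := by
  have short : ∀ n k, blockState m n = (0, 0, k) → ∀ j ≤ m k,
      blockState m (n + 5 + 3 * j) = (0, m k - j, k + 1) := fun n k h j hj =>
    blockState_iterate (by rw [(blockState_long h).2, Nat.sub_add_cancel hj])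
  have start : ∀ k, blockState m (blockPos m k) = (0, 0, k) := by
    intro k
    induction k with
    | zero => rfl
    | succ k ih =>
      rw [blockPos, short _ _ ih _ le_rfl, Nat.sub_self]
  refine ⟨fun k => ⟨(blockState_long (start k)).1, fun j hj => ?_,
    (blockState_long (start (k + 1))).1⟩, fun _ => rfl, hm⟩
  refine (blockState_short (c := m k - j - 1) (k := k + 1) ?_).1
  rw [short _ _ (start k) j hj.le]
  congr 2
  omega

theorem exists_isChain {m : ℕ → ℕ} (hm : ∀ k, 1 ≤ m k) :
    ∃ α, Irrational α ∧ IsChain (digit α) (blockPos m) m := by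
  have ha : ∀ i, 1 ≤ blockDigit m (i + 1 - 1) := fun i => by
    rw [blockDigit]; split_ifs <;> norm_num
  refine ⟨cfValue fun i => blockDigit m (i - 1), irrational_cfValue ha, ?_⟩
  have : digit (cfValue fun i => blockDigit m (i - 1)) = blockDigit m := by
    funext n; rw [digit_cfValue ha]; rfl
  rw [this]
  exact isChain_blockDigit hm

/-! ### Numbers equivalent to the golden ratio and the period `1, 1, 3` -/

theorem lambda2_of_eventually_one {α : ℝ} (hα : Irrational α) {N : ℕ}
    (h : ∀ n, digit α (N + n) = 1) : lambda2 α = (lam 1 : EReal) := by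
  have E := (expansion hα).shift N
  have h5 : √5 ^ 2 = 5 := Real.sq_sqrt (by norm_num)
  have h5' : (2.2 : ℝ) < √5 := Real.lt_sqrt_of_sq_lt (by norm_num)
  have h5'' : √5 < 2.3 := (Real.sqrt_lt' (by norm_num)).2 (by norm_num)
  -- the fixed point `[0; 1, 1, 1, …]`
  set γ := (√5 - 1) / 2 with hγ
  have hγ0 : 0.6 < γ := by rw [hγ]; linarith
  have hγ1 : γ < 0.65 := by rw [hγ]; linarith
  have hfix : γ = 1 / (1 + γ) := by
    rw [eq_div_iff (by linarith), hγ]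
    linear_combination h5 / 4
  have contr : ∀ u, 0 ≤ u → |1 / ((1 : ℕ) + u) - γ| ≤ |u - γ| * (5 / 8) := by
    intro u hu
    have e : 1 / ((1 : ℕ) + u) - γ = -(u - γ) / ((1 + u) * (1 + γ)) := by
      conv_lhs => rw [hfix]
      push_cast
      have : 0 < 1 + γ := by linarith
      field_simp
      ring
    have hpos : 8 / 5 ≤ (1 + u) * (1 + γ) := by norm_num at *; nlinarith
    rw [e, abs_div, abs_neg, abs_of_pos (show 0 < (1 + u) * (1 + γ) by linarith),
      div_le_iff₀ (by linarith)]
    have := mul_le_mul_of_nonneg_left hpos (abs_nonneg (u - γ))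
    linarith
  have hlim : Tendsto (fun j : ℕ => ((5 : ℝ) / 8) ^ j) atTop (𝓝 0) :=
    tendsto_pow_atTop_nhds_zero_of_lt_one (by norm_num) (by norm_num)
  have start : ∀ x ∈ Set.Icc (0 : ℝ) 1, |x - γ| ≤ 1 := fun x hx => by
    rw [abs_le]; constructor <;> linarith [hx.1, hx.2]
  have hr : ∀ n, rightTail α (N + n) = γ := by
    have key : ∀ j n, |rightTail α (N + n) - γ| ≤ (5 / 8) ^ j := by
      intro j
      induction j with
      | zero => exact fun n => by rw [pow_zero]; exact start _ (E.r_mem_Icc n)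
      | succ j ih =>
        intro n
        rw [E.r_eq n, h]
        refine (contr _ (E.r_pos (n + 1)).le).trans ?_
        rw [pow_succ]
        exact mul_le_mul_of_nonneg_right (ih (n + 1)) (by norm_num)
    exact fun n => sub_eq_zero.1 (abs_nonpos_iff.1 (ge_of_tendsto' hlim fun j => key j n))
  have hl : Tendsto (fun n => leftTail (digit α) (N + n)) atTop (𝓝 γ) := by
    refine tendsto_iff_dist_tendsto_zero.2 (squeeze_zero (fun _ => dist_nonneg) (fun n => ?_) hlim)
    induction n with
    | zero => rw [pow_zero]; exact start _ (E.l_mem_Icc 0)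
    | succ n ih =>
      rw [Real.dist_eq] at *
      rw [E.l_succ n, h, pow_succ]
      exact (contr _ (E.l_nonneg n)).trans (mul_le_mul_of_nonneg_right ih (by norm_num))
  have hlam : lam 1 = (1 + γ + γ) / 4 := by
    rw [lam, if_pos rfl, hγ]; ring
  have ht : Tendsto (fun n => (digit α n + leftTail (digit α) n + rightTail α n) / 4) atTop
      (𝓝 (lam 1)) := by
    refine (tendsto_add_atTop_iff_nat N).1 ?_
    rw [hlam]
    refine Tendsto.congr (fun n => ?_) (((hl.const_add 1).add_const γ).div_const 4)
    rw [add_comm n N, h, hr, Nat.cast_one]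
  refine lambda2_eq_of_frequently hα (fun c hc => ?_) fun c hc =>
    (ht.eventually_const_le hc).frequently
  have : 1 / 2 ≤ lam 1 := by rw [hlam]; linarith
  refine lambda2_le_of_eventually_eq_one hα (by linarith) ?_
  filter_upwards [ht.eventually_le_const hc, eventually_ge_atTop N] with n h1 h2
  obtain ⟨n, rfl⟩ := Nat.exists_eq_add_of_le h2
  exact ⟨h n, h1⟩

theorem lam_two : lam 2 = (3 + 2 * eta) / 4 := by
  rw [lam, if_neg (by norm_num), if_pos rfl, eta]; ring

theorem lambda2_of_isShort {α : ℝ} (hα : Irrational α) {N : ℕ}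
    (h : ∀ j, IsShort (digit α) (N + 3 * j)) : lambda2 α = (lam 2 : EReal) := by
  have E := expansion hα
  have he := eta_gt
  have hlim : Tendsto (fun j : ℕ => (2 : ℝ) * (1 / 2) ^ j) atTop (𝓝 0) := by
    simpa using (tendsto_pow_atTop_nhds_zero_of_lt_one (r := (1 / 2 : ℝ)) (by norm_num)
      (by norm_num)).const_mul 2
  have hr : ∀ j, rightTail α (N + 3 * j) = eta := by
    intro j
    refine sub_eq_zero.1 (abs_nonpos_iff.1 (ge_of_tendsto' hlim fun i => ?_))
    have := E.r_iterate (n := N + 3 * j) (m := i) fun k _ => by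
      rw [add_assoc, ← mul_add]; exact h _
    rw [this]
    exact abs_iterate_shortGap_sub_eta_le (E.r_mem_Icc _) _
  have hl : Tendsto (fun j => leftTail (digit α) (N + 3 * j)) atTop (𝓝 eta) := by
    refine tendsto_iff_dist_tendsto_zero.2 (squeeze_zero (fun _ => dist_nonneg) (fun j => ?_) hlim)
    rw [E.l_iterate fun k _ => h k]
    exact abs_iterate_shortGap_sub_eta_le (E.l_mem_Icc _) _
  -- the three values at a `3` have the same limit because `(1 + η) (2 + η) = 4`
  have hprod : (1 + eta) * (2 + eta) = 4 := by linear_combination eta_sq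
  have hval : 1 / (1 + eta) + 1 / (2 + eta) = lam 2 := by
    rw [div_add_div _ _ (by linarith) (by linarith), hprod, lam_two]
    ring
  have t1 : Tendsto (fun j => (3 + leftTail (digit α) (N + 3 * j) + eta) / 4) atTop
      (𝓝 (lam 2)) := by
    rw [lam_two, two_mul, ← add_assoc]
    exact ((hl.const_add 3).add_const eta).div_const 4
  have t2 : Tendsto (fun j => 1 / (1 + leftTail (digit α) (N + 3 * j)) + 1 / (2 + eta)) atTop
      (𝓝 (lam 2)) := by
    rw [← hval]
    exact (tendsto_const_nhds.div (hl.const_add 1) (by linarith)).add_const _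
  have t3 : Tendsto (fun j => 1 / (1 + eta) + 1 / (2 + leftTail (digit α) (N + 3 * j))) atTop
      (𝓝 (lam 2)) := by
    rw [← hval]
    exact (tendsto_const_nhds.div (hl.const_add 2) (by linarith)).const_add _
  have hlam : 1 ≤ lam 2 := by rw [lam_two]; norm_num at *; linarith
  refine lambda2_eq_of_frequently hα (fun c hc => ?_) fun c hc => ?_
  · refine lambda2_le_of_eventually hα (by linarith) ?_
    obtain ⟨J, hJ⟩ := eventually_atTop.1 ((t1.eventually_le_const hc).and
      ((t2.eventually_le_const hc).and (t3.eventually_le_const hc)))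
    filter_upwards [eventually_ge_atTop (N + 3 * J)] with n hn
    obtain ⟨i, rfl⟩ := Nat.exists_eq_add_of_le (show N ≤ n by omega)
    have hi := Nat.div_add_mod i 3
    have hS := h (i / 3)
    obtain ⟨c1, c2, c3⟩ := hJ (i / 3) (by omega)
    have hone : ∀ k, N + i = k → digit α k = 1 →
        AtMostAt (digit α) (leftTail (digit α)) (rightTail α) c (N + i) := fun k hk h1 => by
      subst hk; exact E.atMostAt_of_eq_one (by linarith) h1
    rcases (show i % 3 = 0 ∨ i % 3 = 1 ∨ i % 3 = 2 by omega) with h0 | h0 | h0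
    · rw [show N + i = N + 3 * (i / 3) by omega]
      refine atMostAt_of_eq_three hS.1 ?_ ?_ ?_ <;> rw [hr]
      exacts [c1, c2, c3]
    · exact hone _ (by omega) hS.2.1
    · exact hone _ (by omega) hS.2.2.1
  · rw [frequently_atTop]
    intro M
    obtain ⟨J, hJ⟩ := eventually_atTop.1 (t1.eventually_const_le hc)
    refine ⟨N + 3 * max J M, by have := le_max_right J M; omega, ?_⟩
    rw [(h _).1, hr]
    exact_mod_cast hJ _ (le_max_left J M)

/-! ### The numbers `λ_n` -/

theorem add_longGap_lt {x y : ℝ} (hx : 0 ≤ x) (hxy : x < y) : x + longGap x < y + longGap y := by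
  have h := abs_longGap_sub_le hx (hx.trans hxy.le)
  rw [abs_of_neg (show x - y < 0 by linarith)] at h
  have := (abs_le.1 h).2
  linarith

theorem lt_of_linCoord_lt {x y : ℝ} (hx : 0 ≤ x) (hy : 0 ≤ y) (h : linCoord x < linCoord y) :
    x < y := by
  have := eta_gt
  rw [linCoord, linCoord, div_lt_div_iff₀ (by linarith) (by linarith)] at h
  by_contra! hc
  nlinarith

/-- The periodic value `[0; (1,1,3)_{2n-5}, 1,1,1,1,3, …]` that enters `λ_n`. -/
def blockValue (n : ℕ) : ℝ := shortGap^[2 * n - 5] (xi n)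

theorem blockValue_mem (n : ℕ) : blockValue n ∈ Set.Icc (0 : ℝ) 1 :=
  iterate_shortGap_mem (xi_mem n) _

theorem lam_eq_blockValue {n : ℕ} (hn : 3 ≤ n) :
    lam n = (3 + (blockValue n + longGap (blockValue n))) / 4 := by
  rw [lam_eq hn, blockValue, ← xi_fixed, add_assoc]

theorem lamInf_eq_longGap : lamInf = (3 + (eta + longGap eta)) / 4 := by
  rw [lamInf_eq, longGap_eta]; ring

/-- The sign is negative because the number `2 n - 5` of short gaps is odd. -/
theorem linCoord_blockValue {n : ℕ} (hn : 3 ≤ n) :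
    linCoord (blockValue n) = -(mult ^ (2 * n - 5) * linCoord (xi n)) := by
  rw [blockValue, linCoord_iterate (xi_mem n),
    (show Odd (2 * n - 5) from ⟨n - 3, by omega⟩).neg_pow, neg_mul]

theorem blockValue_lt_eta {n : ℕ} (hn : 3 ≤ n) : blockValue n < eta := by
  have he := eta_gt
  refine lt_of_linCoord_lt (blockValue_mem n).1 (by linarith) ?_
  have h := (linCoord_bounds ⟨xi_ge n, xi_le n⟩).1
  have := mul_pos (pow_pos mult_pos (2 * n - 5)) (show 0 < linCoord (xi n) by linarith)
  rw [linCoord_blockValue hn, show linCoord eta = 0 by rw [linCoord, sub_self, zero_div]]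
  linarith

theorem blockValue_lt_blockValue {n k : ℕ} (hn : 3 ≤ n) (hk : n < k) :
    blockValue n < blockValue k := by
  refine lt_of_linCoord_lt (blockValue_mem n).1 (blockValue_mem k).1 ?_
  obtain ⟨h1, -⟩ := linCoord_bounds ⟨xi_ge n, xi_le n⟩
  obtain ⟨h3, h4⟩ := linCoord_bounds ⟨xi_ge k, xi_le k⟩
  have hm := mult_lt
  have hp := pow_pos mult_pos (2 * n - 5)
  have hpow : mult ^ (2 * k - 5) ≤ mult ^ (2 * n - 5) * (1 / 60) :=
    calc mult ^ (2 * k - 5) ≤ mult ^ (2 * n - 5 + 1) :=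
          pow_le_pow_of_le_one mult_pos.le (by linarith) (by omega)
      _ ≤ mult ^ (2 * n - 5) * (1 / 60) := by
          rw [pow_succ]; exact mul_le_mul_of_nonneg_left hm.le hp.le
  rw [linCoord_blockValue hn, linCoord_blockValue (hn.trans hk.le), neg_lt_neg_iff]
  calc mult ^ (2 * k - 5) * linCoord (xi k)
      ≤ mult ^ (2 * n - 5) * (1 / 60) * 0.012 := by gcongr
    _ < mult ^ (2 * n - 5) * 0.011 := by linarith
    _ ≤ mult ^ (2 * n - 5) * linCoord (xi n) := by gcongr

theorem lam_one_lt_lam_two : lam 1 < lam 2 := by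
  rw [lam, lam, if_pos rfl, if_neg (by norm_num), if_pos rfl]
  have : √5 < √17 := Real.sqrt_lt_sqrt (by norm_num) (by norm_num)
  linarith

theorem lam_two_lt_lam {n : ℕ} (hn : 3 ≤ n) : lam 2 < lam n := by
  have he := eta_lt
  have h1 := xi_ge n
  have h2 := iterate_shortGap_ge (xi_mem n) (show 1 ≤ 2 * n - 5 by omega)
  rw [lam_two, lam_eq hn]
  norm_num at *
  linarith

theorem lam_lt_lam {m n : ℕ} (hm : 1 ≤ m) (hmn : m < n) : lam m < lam n := by
  rcases (show m = 1 ∨ m = 2 ∨ 3 ≤ m by omega) with rfl | rfl | hm3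
  · rcases (show 2 ≤ n by omega).eq_or_lt with rfl | hn
    · exact lam_one_lt_lam_two
    · exact lam_one_lt_lam_two.trans (lam_two_lt_lam hn)
  · exact lam_two_lt_lam hmn
  · rw [lam_eq_blockValue hm3, lam_eq_blockValue (hm3.trans hmn.le)]
    have := add_longGap_lt (blockValue_mem m).1 (blockValue_lt_blockValue hm3 hmn)
    linarith

theorem lam_lt_lamInf {n : ℕ} (hn : 1 ≤ n) : lam n < lamInf := by
  have h3 : ∀ k, 3 ≤ k → lam k < lamInf := fun k hk => by
    rw [lam_eq_blockValue hk, lamInf_eq_longGap]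
    have := add_longGap_lt (blockValue_mem k).1 (blockValue_lt_eta hk)
    linarith
  exact (lam_lt_lam hn (show n < n + 3 by omega)).trans (h3 _ (by omega))

theorem tendsto_lam : Tendsto lam atTop (𝓝 lamInf) := by
  have he := eta_gt
  have hm : Tendsto (fun n : ℕ => 2 * n - 5) atTop atTop :=
    tendsto_atTop_mono (fun n => show n - 5 ≤ 2 * n - 5 by omega) (tendsto_sub_atTop_nat 5)
  have hlim : Tendsto (fun n : ℕ => (2 : ℝ) * (1 / 2) ^ (2 * n - 5)) atTop (𝓝 0) := by
    simpa using ((tendsto_pow_atTop_nhds_zero_of_lt_one (r := (1 / 2 : ℝ)) (by norm_num)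
      (by norm_num)).comp hm).const_mul 2
  have ht : Tendsto blockValue atTop (𝓝 eta) :=
    tendsto_iff_dist_tendsto_zero.2 (squeeze_zero (fun _ => dist_nonneg)
      (fun n => abs_iterate_shortGap_sub_eta_le (xi_mem n) _) hlim)
  have hcont : ContinuousAt longGap eta := by
    unfold longGap
    exact ContinuousAt.div (by fun_prop) (by fun_prop) (by linarith)
  rw [lamInf_eq_longGap]
  refine (((ht.add (hcont.tendsto.comp ht)).const_add 3).div_const 4).congr' ?_
  filter_upwards [eventually_ge_atTop 3] with n hn
  exact (lam_eq_blockValue hn).symm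

/-! ### The spectrum below `λ_∞` -/

/-- A number whose expansion ends in blocks of constant length shares a complete quotient with
`ξ_n`. -/
theorem equivalent_xi_of_isChain {α : ℝ} (hα : Irrational α) {n : ℕ} {p : ℕ → ℕ}
    (C : IsChain (digit α) p fun _ => 2 * n - 5) : Equivalent α (xi n) := by
  have hr := C.r_eq_fixed (expansion hα) (xi_mem n) (xi_fixed n) 0
  have h0 := xi_ge n
  have h1 := xi_le n
  have hf : Int.fract (xi n) = xi n :=
    Int.fract_eq_self.2 ⟨by linarith, by linarith⟩
  refine ⟨p 0 + 2, 1, ?_⟩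
  change (rightTail α (p 0))⁻¹ = (Int.fract (xi n))⁻¹
  rw [hf, hr]

/-- The classification in terms of `λ^{[2]}`. -/
theorem lambda2_cases {α : ℝ} (hα : Irrational α) (h : lambda2 α < (lamInf : EReal)) :
    lambda2 α = (lam 1 : EReal) ∨ lambda2 α = (lam 2 : EReal) ∨
      ∃ n, 3 ≤ n ∧ lambda2 α = (lam n : EReal) ∧ Equivalent α (xi n) := by
  obtain ⟨N, hN⟩ := eventually_atTop.1 (eventually_lt_of_lambda2_lt hα h)
  have E := (expansion hα).shift N
  rcases E.classification fun n => hN (N + n) (by omega) with ⟨M, hM⟩ | ⟨M, hM⟩ | ⟨M, m, hodd, hM⟩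
  · left
    exact lambda2_of_eventually_one hα (N := N + M) fun n => by rw [add_assoc]; exact hM n
  · right; left
    exact lambda2_of_isShort hα (N := N + M) fun j => by rw [add_assoc]; exact hM j
  · right; right
    obtain ⟨i, hi⟩ := hodd
    have C : IsChain (digit α) (fun k => N + (M + k * (5 + 3 * m))) fun _ => 2 * (i + 3) - 5 := by
      rw [show 2 * (i + 3) - 5 = m by omega]
      refine ⟨fun k => ?_, fun k => by ring, fun _ => by omega⟩
      simpa only [IsBlock, IsLong, IsShort, add_assoc] using hM k
    exact ⟨i + 3, by omega, lambda2_of_isChain_const hα (by omega) C,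
      equivalent_xi_of_isChain hα C⟩

theorem lam_mem_spectrum2 {n : ℕ} (hn : 1 ≤ n) : lam n ∈ spectrum2 := by
  rcases (show n = 1 ∨ n = 2 ∨ 3 ≤ n by omega) with rfl | rfl | h3
  · have ha : ∀ i : ℕ, 1 ≤ (fun _ : ℕ => 1) (i + 1) := fun _ => le_rfl
    exact ⟨cfValue fun _ => 1, irrational_cfValue ha,
      lambda2_of_eventually_one (irrational_cfValue ha) (N := 0)
        fun n => digit_cfValue (a := fun _ => 1) ha _⟩
  · have ha : ∀ i, 1 ≤ periodicFrom 3 [1, 1, 3] (i + 1) := periodicFrom_pos (by simp) (by simp)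
    refine ⟨_, irrational_cfValue ha, lambda2_of_isShort (irrational_cfValue ha) (N := 2)
      fun j => ?_⟩
    simp only [IsShort, digit_cfValue ha, periodicFrom, List.length_cons, List.length_nil]
    rw [show (2 + 3 * j) % (0 + 1 + 1 + 1) = 2 by omega,
      show (2 + 3 * j + 1) % (0 + 1 + 1 + 1) = 0 by omega,
      show (2 + 3 * j + 2) % (0 + 1 + 1 + 1) = 1 by omega,
      show (2 + 3 * j + 3) % (0 + 1 + 1 + 1) = 2 by omega]
    simp
  · obtain ⟨α, hα, C⟩ := exists_isChain (m := fun _ => 2 * n - 5) fun _ => by omega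
    exact ⟨α, hα, lambda2_of_isChain_const hα h3 C⟩

theorem lamInf_mem_spectrum2 : lamInf ∈ spectrum2 := by
  obtain ⟨α, hα, C⟩ := exists_isChain (m := fun k => k + 1) fun _ => by omega
  exact ⟨α, hα, lambda2_of_isChain_tendsto hα C (tendsto_add_atTop_nat 1)⟩

theorem spectrum2_below_lamInf :
    Set.Iio lamInf ∩ spectrum2 = {l : ℝ | ∃ n : ℕ, 1 ≤ n ∧ l = lam n} := by
  ext x
  constructor
  · rintro ⟨hx, α, hα, he⟩
    have hlt : lambda2 α < (lamInf : EReal) := by rw [he]; exact_mod_cast hx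
    rcases lambda2_cases hα hlt with h | h | ⟨n, hn, h, -⟩
    · exact ⟨1, le_rfl, by exact_mod_cast he.symm.trans h⟩
    · exact ⟨2, by norm_num, by exact_mod_cast he.symm.trans h⟩
    · exact ⟨n, by omega, by exact_mod_cast he.symm.trans h⟩
  · rintro ⟨n, hn, rfl⟩
    exact ⟨lam_lt_lamInf hn, lam_mem_spectrum2 hn⟩

theorem isDiscrete_setOf_lam : IsDiscrete {l : ℝ | ∃ n : ℕ, 1 ≤ n ∧ l = lam n} := by
  rw [isDiscrete_iff_forall_mem_exists_isOpen]
  rintro _ ⟨n, hn, rfl⟩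
  refine ⟨Set.Ioo (if n = 1 then lam 1 - 1 else lam (n - 1)) (lam (n + 1)), isOpen_Ioo, ?_⟩
  have hlow : (if n = 1 then lam 1 - 1 else lam (n - 1)) < lam n := by
    split_ifs with h
    · rw [h]; linarith
    · exact lam_lt_lam (by omega) (by omega)
  refine Set.eq_singleton_iff_unique_mem.2
    ⟨⟨⟨hlow, lam_lt_lam hn (Nat.lt_succ_self n)⟩, n, hn, rfl⟩, ?_⟩
  rintro _ ⟨⟨h1, h2⟩, k, hk, rfl⟩
  rcases lt_trichotomy k n with h | rfl | h
  · exfalso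
    rw [if_neg (by omega)] at h1
    rcases (show k ≤ n - 1 by omega).eq_or_lt with rfl | h'
    · exact lt_irrefl _ h1
    · exact (lam_lt_lam hk h').not_gt h1
  · rfl
  · exfalso
    rcases (show n + 1 ≤ k by omega).eq_or_lt with rfl | h'
    · exact lt_irrefl _ h2
    · exact (lam_lt_lam (by omega) h').not_gt h2

theorem equivalent_xi_of_lambda2_eq {n : ℕ} (hn : 3 ≤ n) {α : ℝ} (hα : Irrational α)
    (h : lambda2 α = (lam n : EReal)) : Equivalent α (xi n) := by
  have inj : ∀ k, 1 ≤ k → lambda2 α = (lam k : EReal) → k = n := by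
    intro k hk hk'
    have he : lam k = lam n := by exact_mod_cast hk'.symm.trans h
    rcases lt_trichotomy k n with hlt | rfl | hlt
    · exact absurd he (lam_lt_lam hk hlt).ne
    · rfl
    · exact absurd he (lam_lt_lam (by omega) hlt).ne'
  have hlt : lambda2 α < (lamInf : EReal) := by
    rw [h]; exact_mod_cast lam_lt_lamInf (show 1 ≤ n by omega)
  rcases lambda2_cases hα hlt with h1 | h2 | ⟨k, hk, hk', he⟩
  · have := inj 1 le_rfl h1
    omega
  · have := inj 2 (by norm_num) h2
    omega
  · rwa [inj k (by omega) hk'] at he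

end SecondLagrange

end

theorem theorem1 :
    -- the spectrum below `λ_∞` is `{λ₁ < λ₂ < λ₃ < …}`, a discrete set, and `λ_n → λ_∞`
    (Set.Iio SecondLagrange.lamInf ∩ SecondLagrange.spectrum2 =
        {l : ℝ | ∃ n : ℕ, 1 ≤ n ∧ l = SecondLagrange.lam n} ∧
      (∀ m n : ℕ, 1 ≤ m → m < n → SecondLagrange.lam m < SecondLagrange.lam n) ∧
      Tendsto SecondLagrange.lam atTop (𝓝 SecondLagrange.lamInf) ∧
      IsDiscrete (Set.Iio SecondLagrange.lamInf ∩ SecondLagrange.spectrum2) ∧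
      SecondLagrange.lamInf ∈ SecondLagrange.spectrum2) ∧
    -- the numbers with `λ^{[2]}(α) = λ_n`, `n ≥ 3`, are equivalent to `ξ_n`
    (∀ n : ℕ, 3 ≤ n → ∀ α : ℝ, Irrational α →
      SecondLagrange.lambda2 α = (SecondLagrange.lam n : EReal) →
      SecondLagrange.Equivalent α (SecondLagrange.xi n)) := by
  open SecondLagrange in
  exact ⟨⟨spectrum2_below_lamInf, fun _ _ => lam_lt_lam, tendsto_lam,
    spectrum2_below_lamInf ▸ isDiscrete_setOf_lam, lamInf_mem_spectrum2⟩,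
    fun _ hn _ hα h => equivalent_xi_of_lambda2_eq hn hα h⟩
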